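/- **Theorem 6 (Convergence rate).** Let $n\ge 2$, $A^*\in\mathbb{R}^{n\times n}$, $c^*\in\mathbb{R}^n$, and let $\theta^*=\mathrm{vec}(A^*\;c^*)\in\mathbb{R}^{n(n+1)}$ be the row-wise vectorization of the $n\times(n+1)$ matrix $(A^*\;c^*)$. On a probability space consider, for $k\ge 0$, the system $$Y_{k+1}=A^*S_k+D_k,\qquad S_k=\bigl(\mathbb{I}_{[Y_{k,1}\ge c^*_1]},\dots,\mathbb{I}_{[Y_{k,n}\ge c^*_n]}\bigr)^T,$$ where the disturbances $D_{k,i}$ ($k\ge0$, $1\le i\le n$) are independent standard Gaussian random variables, jointly independent of $S_0$ (whose law is arbitrary). For $\theta^{(i)}=(A_i\;c_i)^T\in\mathbb{R}^{n+1}$ and $s',s\in\{0,1\}^n$ put $$g_i\bigl((s',s)\,\big|\,\theta^{(i)}\bigr)=\bigl(1-\Phi(c_i-A_is)\bigr)^{s'_i}\,\Phi(c_i-A_is)^{1-s'_i},$$ with $\Phi$ the standard Gaussian distribution function, and for $\theta=(\theta^{(1)},\dots,\theta^{(n)})$ let $K(\theta,(s',s))\in\mathbb{R}^{n(n+1)}$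 be the concatenation of the vectors $\nabla_{\theta^{(i)}}\log g_i((s',s)\,|\,\theta^{(i)})$, $1\le i\le n$. From an arbitrary fixed initial value $\theta_0\in\mathbb{R}^{n(n+1)}$ define the estimates $$\theta_{k+1}=\theta_k+a_k\,K\bigl(\theta_k,(S_{k+1},S_k)\bigr),\qquad a_k=\frac{a}{k^{1-\beta}+\gamma},\qquad k\ge0,$$ with $a,\gamma>0$. 1. If $\beta\in(0,1/3)$, then almost surely $\|\theta_k-\theta^*\|=o(k^{-\delta})$ as $k\to\infty$ for every $\delta\in(0,\tfrac12-\beta)$. 2. If $\beta=0$, then there exists $\delta'\in(0,\tfrac12]$, depending only on $\theta^*$ (hence $n$) and $a$, such that almost surely $\|\theta_k-\theta^*\|=o(k^{-\delta})$ as $k\to\infty$ for every $\delta\in(0,\delta')$. Here $\|\cdot\|$ is the Euclidean norm. -/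

import Mathlib

open MeasureTheory ProbabilityTheory Filter Asymptotics

noncomputable section

namespace BinaryNetwork

/-- Binary observation vectors, i.e. elements of `{0, 1}^n`. -/
abbrev Obs (n : ℕ) : Type := Fin n → Fin 2

/-- The real number `0` or `1` represented by an entry of an observation vector. -/
def bit (b : Fin 2) : ℝ := ((b : ℕ) : ℝ)

/-- Parameter vectors `θ = vec (A c) ∈ ℝ^{n(n+1)}` with the Euclidean norm, where `(A c)` is
an `n × (n+1)` matrix whose last column is `c`. -/
abbrev Param (n : ℕ) : Type := EuclideanSpace ℝ (Fin n × Fin (n + 1))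

/-- The parameter `θ⁽ⁱ⁾ = (A_i c_i)ᵀ ∈ ℝ^{n+1}` of a single agent; the last entry is `c_i`. -/
abbrev RowParam (n : ℕ) : Type := EuclideanSpace ℝ (Fin (n + 1))

/-- `vec (A c)`. -/
def vecParam {n : ℕ} (A : Matrix (Fin n) (Fin n) ℝ) (c : Fin n → ℝ) : Param n :=
  WithLp.toLp 2 fun p => Fin.snoc (α := fun _ => ℝ) (A p.1) (c p.1) p.2

/-- The block `θ⁽ⁱ⁾` of `θ`. -/
def Param.row {n : ℕ} (θ : Param n) (i : Fin n) : RowParam n :=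
  WithLp.toLp 2 fun j => θ (i, j)

/-- The quantizer: entry `i` is `1` if `y_i ≥ c_i`, and `0` otherwise. -/
def quantize {n : ℕ} (y c : Fin n → ℝ) : Obs n :=
  fun i => if c i ≤ y i then 1 else 0

/-- The dynamics `Y_{k+1} = A S_k + D_k`, `S_k = Q(Y_k, c)`. -/
structure IsSystem {n : ℕ} {Ω : Type*} (A : Matrix (Fin n) (Fin n) ℝ) (c : Fin n → ℝ)
    (D : ℕ → Fin n → Ω → ℝ) (Y : ℕ → Ω → Fin n → ℝ) (S : ℕ → Ω → Obs n) : Prop where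
  state : ∀ k ω i, Y (k + 1) ω i = ∑ j, A i j * bit (S k ω j) + D k i ω
  obs : ∀ k ω, S k ω = quantize (Y k ω) c

/-- The random variables `D_{k,i}` are standard Gaussian, independent over all pairs `(k, i)`,
and the whole family is independent of the random vector `S_0`. -/
structure IsGaussianDisturbance {n : ℕ} {Ω : Type*} [MeasurableSpace Ω] (P : Measure Ω)
    (D : ℕ → Fin n → Ω → ℝ) (S₀ : Ω → Obs n) : Prop where
  measurable_disturbance : ∀ k i, Measurable (D k i)
  measurable_init : Measurable S₀
  law : ∀ k i, P.map (D k i) = gaussianReal 0 1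
  indep : iIndepFun (fun p : ℕ × Fin n => D p.1 p.2) P
  indep_init : IndepFun (fun ω (p : ℕ × Fin n) => D p.1 p.2 ω) S₀ P

/-- The standard Gaussian cumulative distribution function. -/
def Phi (x : ℝ) : ℝ := cdf (gaussianReal 0 1) x

/-- `c_i - A_i s`, as a function of `θ⁽ⁱ⁾ = (A_i c_i)ᵀ`. -/
def RowParam.gap {n : ℕ} (t : RowParam n) (s : Obs n) : ℝ :=
  t (Fin.last n) - ∑ j : Fin n, t j.castSucc * bit (s j)

/-- The one-agent likelihood
`g_i(z | θ⁽ⁱ⁾) = (1 - Φ(c_i - A_i s))^{s'_i} Φ(c_i - A_i s)^{1 - s'_i}`,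
where `z = (s', s)` consists of the current observation `s'` and the previous one `s`. -/
def likelihood {n : ℕ} (i : Fin n) (z : Obs n × Obs n) (t : RowParam n) : ℝ :=
  (1 - Phi (t.gap z.2)) ^ (z.1 i : ℕ) * Phi (t.gap z.2) ^ (1 - (z.1 i : ℕ))

/-- `K_i(θ⁽ⁱ⁾, z) = ∇_{θ⁽ⁱ⁾} log g_i(z | θ⁽ⁱ⁾)`. -/
def scoreRow {n : ℕ} (i : Fin n) (t : RowParam n) (z : Obs n × Obs n) : RowParam n :=
  gradient (fun u : RowParam n => Real.log (likelihood i z u)) t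

/-- `K(θ, z)`, the concatenation of the `K_i(θ⁽ⁱ⁾, z)`. -/
def score {n : ℕ} (θ : Param n) (z : Obs n × Obs n) : Param n :=
  WithLp.toLp 2 fun p => scoreRow p.1 (θ.row p.1) z p.2

/-- The step size `a_k = a / (k^{1-β} + γ)`. -/
def stepSize (a β γ : ℝ) (k : ℕ) : ℝ := a / ((k : ℝ) ^ (1 - β) + γ)

/-- The estimates `θ_{k+1} = θ_k + a_k K(θ_k, (S_{k+1}, S_k))` along an observed path,
started from `θ₀`. -/
def estimate {n : ℕ} (step : ℕ → ℝ) (θ₀ : Param n) (s : ℕ → Obs n) : ℕ → Param n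
  | 0 => θ₀
  | k + 1 => estimate step θ₀ s k +
      step k • score (estimate step θ₀ s k) (s (k + 1), s k)

end BinaryNetwork

end

universe u

open BinaryNetwork

/-! The score of one agent is the regressor `(-s, 1)` times the derivative of a binary
log-likelihood in the gap. Since `Phi` is increasing, its conditional mean never points away from
the true parameter, and a Mills-ratio bound shows that it grows at most linearly. With
square-summable steps the squared error is therefore nearly a supermartingale and stays bounded
almost surely (`ae_exists_sqError_le`).

On bounded sets the mean score contracts the error, but only in the directions seen at the current
observation. Every observation follows every other with probability at least some `p > 0`, and the
regressors of all observations span the space, so averaging over the next observation restores a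
full contraction. For this, `lyapunov` subtracts from the squared error the decrease due in the
coming step; its conditional mean contracts by `1 - ρ * step (k + 1)`, up to an error of order `step
k ^ 2` (`sum_transProb_mul_lyapunov_update_le`). Weighted by `k ^ (2 * q)` it is still a
supermartingale up to a summable error (`exists_ae_weighted_sqError_le`) if `q < 1 / 2 - β`, for
summability, and if the weight grows more slowly than the contraction, which restricts `q` only when
`β = 0`.

The constant `ρ` depends on a bound `R` for the squared error, and that bound is random. For `β > 0`
this is harmless, because the steps dominate `1 / k`. For `β = 0` a rate depending on `R` first
gives convergence; then the squared error is eventually at most `1`, and the rate belonging to `R =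
1` takes over. -/

namespace BinaryNetwork

/-! ### Gaussian density, distribution function and Mills-ratio bounds -/

/-- The standard Gaussian density. -/
noncomputable def stdPDF (x : ℝ) : ℝ := gaussianPDFReal 0 1 x

lemma stdPDF_eq (x : ℝ) : stdPDF x = (√(2 * Real.pi))⁻¹ * Real.exp (-(x ^ 2) / 2) := by
  simp [stdPDF, gaussianPDFReal_def]

lemma stdPDF_pos (x : ℝ) : 0 < stdPDF x := gaussianPDFReal_pos 0 1 x one_ne_zero

lemma continuous_stdPDF : Continuous stdPDF := by
  have : stdPDF = fun x => (√(2 * Real.pi))⁻¹ * Real.exp (-(x ^ 2) / 2) := funext stdPDF_eq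
  rw [this]
  fun_prop

lemma stdPDF_le_of_sq_le {x y : ℝ} (h : x ^ 2 ≤ y ^ 2) : stdPDF y ≤ stdPDF x := by
  rw [stdPDF_eq, stdPDF_eq]
  gcongr

lemma stdPDF_le_exp_mul_of_sq_le {x y : ℝ} (h : y ^ 2 ≤ x ^ 2 + 3) :
    stdPDF x ≤ Real.exp (3 / 2) * stdPDF y := by
  rw [stdPDF_eq, stdPDF_eq, mul_left_comm, ← Real.exp_add]
  gcongr
  linarith

lemma Phi_eq_measureReal (x : ℝ) : Phi x = (gaussianReal 0 1).real (Set.Iic x) := cdf_eq_real _ _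

lemma Phi_eq_integral (x : ℝ) : Phi x = ∫ t in Set.Iic x, stdPDF t := by
  rw [Phi_eq_measureReal, Measure.real, gaussianReal_apply_eq_integral _ one_ne_zero,
    ENNReal.toReal_ofReal (integral_nonneg fun t => gaussianPDFReal_nonneg 0 1 t)]
  rfl

lemma integrable_stdPDF : Integrable stdPDF := integrable_gaussianPDFReal 0 1

lemma hasDerivAt_Phi (x : ℝ) : HasDerivAt Phi (stdPDF x) x := by
  have h : Phi = fun y => Phi 0 + ∫ t in (0 : ℝ)..y, stdPDF t := by
    funext y
    rw [← intervalIntegral.integral_Iic_sub_Iic integrable_stdPDF.integrableOn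
      integrable_stdPDF.integrableOn, ← Phi_eq_integral, ← Phi_eq_integral]
    ring
  rw [h]
  exact (intervalIntegral.integral_hasDerivAt_right
    (integrable_stdPDF.intervalIntegrable)
    (continuous_stdPDF.stronglyMeasurableAtFilter _ _) continuous_stdPDF.continuousAt).const_add _

lemma continuous_Phi : Continuous Phi :=
  continuous_iff_continuousAt.2 fun x => (hasDerivAt_Phi x).continuousAt

lemma strictMono_Phi : StrictMono Phi :=
  strictMono_of_hasDerivAt_pos hasDerivAt_Phi stdPDF_pos

lemma Phi_pos (x : ℝ) : 0 < Phi x :=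
  (cdf_nonneg _ (x - 1)).trans_lt (strictMono_Phi (by linarith))

lemma Phi_lt_one (x : ℝ) : Phi x < 1 :=
  (strictMono_Phi (by linarith : x < x + 1)).trans_le (cdf_le_one _ _)

lemma exists_Phi_sub_eq {x y : ℝ} (h : x < y) :
    ∃ t ∈ Set.Ioo x y, Phi y - Phi x = stdPDF t * (y - x) := by
  obtain ⟨t, ht, he⟩ := exists_hasDerivAt_eq_slope Phi stdPDF h continuous_Phi.continuousOn
    fun t _ => hasDerivAt_Phi t
  exact ⟨t, ht, by rw [he, div_mul_cancel₀ _ (by linarith)]⟩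

/-- Within distance `1 / (1 + |x|)` of `x` the squared argument grows by at most `2 + 1`, so the
density drops at most by the factor `exp (3 / 2)`; the mean value theorem does the rest. Stepping
left or right from `x` bounds the two Mills ratios. -/
lemma stdPDF_le_mul_Phi_sub {x y : ℝ} (h : |y - x| = 1 / (1 + |x|)) :
    stdPDF x ≤ Real.exp (3 / 2) * (1 + |x|) * |Phi y - Phi x| := by
  have hx : 0 < 1 + |x| := by positivity
  have hne : x ≠ y := by
    rintro rfl
    simp at h
    exact hx.ne h
  obtain ⟨t, ht, he⟩ : ∃ t, |t - x| ≤ |y - x| ∧ |Phi y - Phi x| = stdPDF t * |y - x| := by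
    rcases lt_or_gt_of_ne hne with hlt | hlt
    · obtain ⟨t, ht, he⟩ := exists_Phi_sub_eq hlt
      refine ⟨t, ?_, by rw [he, abs_mul, abs_of_pos (stdPDF_pos t)]⟩
      rw [abs_of_pos (by linarith [ht.1]), abs_of_pos (by linarith)]
      linarith [ht.2]
    · obtain ⟨t, ht, he⟩ := exists_Phi_sub_eq hlt
      refine ⟨t, ?_, by rw [abs_sub_comm, he, abs_mul, abs_of_pos (stdPDF_pos t), abs_sub_comm]⟩
      rw [abs_of_neg (by linarith [ht.2]), abs_of_neg (by linarith)]
      linarith [ht.1]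
  have h1 : |t - x| * (1 + |x|) ≤ 1 := by
    rw [← le_div_iff₀ hx, ← h]
    exact ht
  have hsq : t ^ 2 ≤ x ^ 2 + 3 := by
    have h2 : |t - x| ≤ 1 := by nlinarith [abs_nonneg (t - x), abs_nonneg x]
    have h3 : x * (t - x) ≤ |t - x| * |x| := by
      rw [mul_comm, ← abs_mul]
      exact le_abs_self _
    have h4 : (t - x) ^ 2 ≤ 1 := by
      rw [← sq_abs]
      nlinarith [abs_nonneg (t - x)]
    nlinarith [abs_nonneg (t - x)]
  rw [he, h]
  calc stdPDF x ≤ Real.exp (3 / 2) * stdPDF t := stdPDF_le_exp_mul_of_sq_le hsq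
    _ = _ := by field_simp

lemma stdPDF_le_mul_Phi (x : ℝ) : stdPDF x ≤ Real.exp (3 / 2) * (1 + |x|) * Phi x := by
  have hx : 0 < 1 / (1 + |x|) := by positivity
  refine (stdPDF_le_mul_Phi_sub (y := x - 1 / (1 + |x|)) ?_).trans ?_
  · rw [sub_sub_cancel_left, abs_neg, abs_of_pos hx]
  · have h1 := strictMono_Phi (by linarith : x - 1 / (1 + |x|) < x)
    have h2 := Phi_pos (x - 1 / (1 + |x|))
    gcongr
    rw [abs_of_neg (by linarith)]
    linarith

lemma stdPDF_le_mul_one_sub_Phi (x : ℝ) :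
    stdPDF x ≤ Real.exp (3 / 2) * (1 + |x|) * (1 - Phi x) := by
  have hx : 0 < 1 / (1 + |x|) := by positivity
  refine (stdPDF_le_mul_Phi_sub (y := x + 1 / (1 + |x|)) ?_).trans ?_
  · rw [add_sub_cancel_left, abs_of_pos hx]
  · have h1 := strictMono_Phi (by linarith : x < x + 1 / (1 + |x|))
    have h2 := Phi_lt_one (x + 1 / (1 + |x|))
    gcongr
    rw [abs_of_pos (by linarith)]
    linarith

/-! ### The binary log-likelihood as a function of the gap -/

/-- The derivative of the one-agent log-likelihood with respect to the gap. -/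
noncomputable def slope (b : Fin 2) (u : ℝ) : ℝ :=
  if b = 0 then stdPDF u / Phi u else -(stdPDF u / (1 - Phi u))

lemma continuous_slope (b : Fin 2) : Continuous (slope b) := by
  unfold slope
  split_ifs
  · exact continuous_stdPDF.div continuous_Phi fun x => (Phi_pos x).ne'
  · exact (continuous_stdPDF.div (continuous_const.sub continuous_Phi)
      fun x => (sub_pos.2 (Phi_lt_one x)).ne').neg

lemma abs_slope_le (b : Fin 2) (u : ℝ) : |slope b u| ≤ Real.exp (3 / 2) * (1 + |u|) := by
  unfold slope
  have h1 := Phi_pos u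
  have h2 := sub_pos.2 (Phi_lt_one u)
  have h3 := stdPDF_pos u
  split_ifs
  · rw [abs_of_pos (by positivity), div_le_iff₀ h1]
    exact stdPDF_le_mul_Phi u
  · rw [abs_neg, abs_of_pos (by positivity), div_le_iff₀ h2]
    exact stdPDF_le_mul_one_sub_Phi u

/-- The probability that an entry with gap `u` takes the value `b`. -/
noncomputable def bitProb (u : ℝ) (b : Fin 2) : ℝ := if b = 0 then Phi u else 1 - Phi u

lemma bitProb_pos (u : ℝ) (b : Fin 2) : 0 < bitProb u b := by
  unfold bitProb
  split_ifs
  exacts [Phi_pos u, sub_pos.2 (Phi_lt_one u)]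

lemma sum_bitProb (u : ℝ) : ∑ b, bitProb u b = 1 := by
  simp [bitProb]

lemma sum_bitProb_mul_slope (v u : ℝ) :
    ∑ b, bitProb v b * slope b u =
      stdPDF u / (Phi u * (1 - Phi u)) * (Phi v - Phi u) := by
  have h1 := (Phi_pos u).ne'
  have h2 := (sub_pos.2 (Phi_lt_one u)).ne'
  simp only [bitProb, slope, Fin.sum_univ_two, if_true, one_ne_zero, if_false]
  field_simp
  ring

lemma stdPDF_mul_sq_le {B u v : ℝ} (hu : |u| ≤ B) (hv : |v| ≤ B) :
    stdPDF B * (u - v) ^ 2 ≤ (u - v) * (Phi u - Phi v) := by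
  wlog h : v < u generalizing u v
  · rcases eq_or_lt_of_le (not_lt.1 h) with rfl | h'
    · simp
    · have := this hv hu h'
      linarith
  obtain ⟨t, ht, he⟩ := exists_Phi_sub_eq h
  have : stdPDF B ≤ stdPDF t := by
    refine stdPDF_le_of_sq_le (sq_le_sq' ?_ ?_)
    · linarith [ht.1, (abs_le.1 hv).1]
    · linarith [ht.2, (abs_le.1 hu).2]
  rw [he]
  nlinarith [sq_nonneg (u - v)]

/-- The expected slope points towards the true gap `v`. -/
lemma mul_sum_bitProb_mul_slope_le (v u : ℝ) : (u - v) * ∑ b, bitProb v b * slope b u ≤ 0 := by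
  have h1 := Phi_pos u
  have h2 := sub_pos.2 (Phi_lt_one u)
  have h3 := stdPDF_pos u
  rw [sum_bitProb_mul_slope, mul_left_comm]
  refine mul_nonpos_of_nonneg_of_nonpos (by positivity) ?_
  rcases le_total u v with h | h
  · exact mul_nonpos_of_nonpos_of_nonneg (by linarith)
      (by linarith [strictMono_Phi.monotone h])
  · exact mul_nonpos_of_nonneg_of_nonpos (by linarith)
      (by linarith [strictMono_Phi.monotone h])

/-- One factor `stdPDF B` bounds the prefactor of `sum_bitProb_mul_slope`, since `Phi u * (1 - Phi
u) ≤ 1`; the other is the mean value bound for `Phi u - Phi v`. -/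
lemma mul_sum_bitProb_mul_slope_le_neg {B u v : ℝ} (hu : |u| ≤ B) (hv : |v| ≤ B) :
    (u - v) * ∑ b, bitProb v b * slope b u ≤ -(stdPDF B ^ 2 * (u - v) ^ 2) := by
  have h1 := Phi_pos u
  have h2 := sub_pos.2 (Phi_lt_one u)
  have hB := stdPDF_pos B
  have hBu : stdPDF B ≤ stdPDF u :=
    stdPDF_le_of_sq_le (by rw [← sq_abs u]; gcongr)
  have hr : stdPDF B ≤ stdPDF u / (Phi u * (1 - Phi u)) := by
    rw [le_div_iff₀ (by positivity)]
    nlinarith [sq_nonneg (Phi u)]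
  have hm := stdPDF_mul_sq_le hu hv
  rw [sum_bitProb_mul_slope]
  have : stdPDF B * (stdPDF B * (u - v) ^ 2) ≤
      stdPDF u / (Phi u * (1 - Phi u)) * ((u - v) * (Phi u - Phi v)) :=
    mul_le_mul hr hm (by positivity) (hB.le.trans hr)
  linarith

/-! ### The score, its mean under the transition law, and excitation of all directions -/

section Score

variable {n : ℕ}

/-- The vector `(-s, 1)`, which represents the linear form `θ⁽ⁱ⁾ ↦ c_i - A_i s`. -/
noncomputable def regressor (s : Obs n) : RowParam n :=
  WithLp.toLp 2 (Fin.snoc (α := fun _ => ℝ) (fun j => -bit (s j)) 1)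

lemma inner_regressor (s : Obs n) (t : RowParam n) : inner ℝ (regressor s) t = t.gap s := by
  simp [PiLp.inner_apply, regressor, RowParam.gap, Fin.sum_univ_castSucc, Fin.snoc_last,
    Fin.snoc_castSucc, -Fin.natCast_eq_last]
  ring

lemma bit_sq_le (b : Fin 2) : bit b ^ 2 ≤ 1 := by
  fin_cases b <;> simp [bit]

lemma norm_regressor_sq_le (s : Obs n) : ‖regressor s‖ ^ 2 ≤ n + 1 := by
  rw [EuclideanSpace.norm_sq_eq, Fin.sum_univ_castSucc]
  simp only [regressor, Fin.snoc_last, Fin.snoc_castSucc, Real.norm_eq_abs, sq_abs, neg_sq]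
  have : ∑ j : Fin n, bit (s j) ^ 2 ≤ ∑ _j : Fin n, (1 : ℝ) :=
    Finset.sum_le_sum fun j _ => bit_sq_le (s j)
  simp at this
  linarith

lemma gap_sq_le (t : RowParam n) (s : Obs n) : t.gap s ^ 2 ≤ (n + 1) * ‖t‖ ^ 2 := by
  rw [← inner_regressor, ← sq_abs]
  calc |inner ℝ (regressor s) t| ^ 2 ≤ (‖regressor s‖ * ‖t‖) ^ 2 := by
        gcongr
        exact abs_real_inner_le_norm _ _
    _ = ‖regressor s‖ ^ 2 * ‖t‖ ^ 2 := by ring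
    _ ≤ _ := by gcongr; exact norm_regressor_sq_le s

lemma gap_add (t t' : RowParam n) (s : Obs n) : (t + t').gap s = t.gap s + t'.gap s := by
  simp only [← inner_regressor, inner_add_right]

lemma gap_sub (t t' : RowParam n) (s : Obs n) : (t - t').gap s = t.gap s - t'.gap s := by
  simp only [← inner_regressor, inner_sub_right]

lemma continuous_gap (s : Obs n) : Continuous fun t : RowParam n => t.gap s := by
  simp only [← inner_regressor]
  fun_prop

lemma hasGradientAt_gap (t : RowParam n) (s : Obs n) :
    HasGradientAt (fun u : RowParam n => u.gap s) (regressor s) t := by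
  rw [hasGradientAt_iff_hasFDerivAt]
  simp only [← inner_regressor]
  exact (InnerProductSpace.toDual ℝ (RowParam n) (regressor s)).hasFDerivAt

lemma likelihood_eq_bitProb (i : Fin n) (z : Obs n × Obs n) (t : RowParam n) :
    likelihood i z t = bitProb (t.gap z.2) (z.1 i) := by
  unfold likelihood bitProb
  generalize z.1 i = b
  fin_cases b <;> simp

lemma hasDerivAt_log_bitProb (b : Fin 2) (u : ℝ) :
    HasDerivAt (fun v => Real.log (bitProb v b)) (slope b u) u := by
  unfold bitProb slope
  split_ifs
  · exact (hasDerivAt_Phi u).log (Phi_pos u).ne'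
  · rw [← neg_div]
    exact ((hasDerivAt_Phi u).const_sub 1).log (sub_pos.2 (Phi_lt_one u)).ne'

lemma scoreRow_eq (i : Fin n) (t : RowParam n) (z : Obs n × Obs n) :
    scoreRow i t z = slope (z.1 i) (t.gap z.2) • regressor z.2 := by
  refine HasGradientAt.gradient ?_
  simp only [likelihood_eq_bitProb]
  have h := (hasDerivAt_log_bitProb (z.1 i) (t.gap z.2)).comp_hasFDerivAt t
    (hasGradientAt_iff_hasFDerivAt.1 (hasGradientAt_gap t z.2))
  rw [hasGradientAt_iff_hasFDerivAt, map_smulₛₗ]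
  exact h

lemma row_add (θ θ' : Param n) (i : Fin n) : (θ + θ').row i = θ.row i + θ'.row i := rfl

lemma row_sub (θ θ' : Param n) (i : Fin n) : (θ - θ').row i = θ.row i - θ'.row i := rfl

lemma row_score (θ : Param n) (z : Obs n × Obs n) (i : Fin n) :
    (score θ z).row i = slope (z.1 i) ((θ.row i).gap z.2) • regressor z.2 := by
  rw [← scoreRow_eq]
  rfl

lemma continuous_row (i : Fin n) : Continuous fun θ : Param n => θ.row i := by
  unfold Param.row
  fun_prop

lemma continuous_score (z : Obs n × Obs n) : Continuous fun θ : Param n => score θ z := by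
  unfold score
  simp only [scoreRow_eq]
  refine (PiLp.continuous_toLp 2 _).comp (continuous_pi fun p => ?_)
  exact (((continuous_slope _).comp ((continuous_gap _).comp (continuous_row _))).mul
    continuous_const)

lemma norm_sq_eq_sum_row (θ : Param n) : ‖θ‖ ^ 2 = ∑ i, ‖θ.row i‖ ^ 2 := by
  simp [EuclideanSpace.norm_sq_eq, Fintype.sum_prod_type, Param.row]

lemma inner_eq_sum_row (θ θ' : Param n) : inner ℝ θ θ' = ∑ i, inner ℝ (θ.row i) (θ'.row i) := by
  simp [PiLp.inner_apply, Fintype.sum_prod_type, Param.row]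

lemma inner_score (e θ : Param n) (z : Obs n × Obs n) :
    inner ℝ e (score θ z) =
      ∑ i, (e.row i).gap z.2 * slope (z.1 i) ((θ.row i).gap z.2) := by
  rw [inner_eq_sum_row]
  refine Finset.sum_congr rfl fun i _ => ?_
  rw [row_score, real_inner_smul_right, real_inner_comm, inner_regressor, mul_comm]

lemma slope_sq_le (b : Fin 2) (u : ℝ) :
    slope b u ^ 2 ≤ 2 * Real.exp (3 / 2) ^ 2 * (1 + u ^ 2) := by
  rw [← sq_abs (slope b u)]
  calc |slope b u| ^ 2 ≤ (Real.exp (3 / 2) * (1 + |u|)) ^ 2 := by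
        gcongr
        exact abs_slope_le b u
    _ = Real.exp (3 / 2) ^ 2 * (1 + |u|) ^ 2 := by ring
    _ ≤ Real.exp (3 / 2) ^ 2 * (2 * (1 + u ^ 2)) := by
        gcongr
        nlinarith [sq_nonneg (1 - |u|), sq_abs u]
    _ = _ := by ring

/-- The score grows at most linearly. -/
lemma exists_norm_score_sq_le (θs : Param n) :
    ∃ C : ℝ, 0 < C ∧ ∀ θ z, ‖score θ z‖ ^ 2 ≤ C * (1 + ‖θ - θs‖ ^ 2) := by
  have key : ∀ (θ : Param n) z, ‖score θ z‖ ^ 2 ≤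
      2 * Real.exp (3 / 2) ^ 2 * (n + 1) ^ 2 * (1 + ‖θ‖ ^ 2) := by
    intro θ z
    calc ‖score θ z‖ ^ 2
        = ∑ i, slope (z.1 i) ((θ.row i).gap z.2) ^ 2 * ‖regressor z.2‖ ^ 2 := by
          rw [norm_sq_eq_sum_row]
          refine Finset.sum_congr rfl fun i _ => ?_
          rw [row_score, norm_smul, mul_pow, Real.norm_eq_abs, sq_abs]
      _ ≤ ∑ i, 2 * Real.exp (3 / 2) ^ 2 * (1 + (n + 1) * ‖θ.row i‖ ^ 2) * (n + 1) := by
          gcongr with i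
          · exact (slope_sq_le _ _).trans (by gcongr; exact gap_sq_le _ _)
          · exact norm_regressor_sq_le _
      _ = 2 * Real.exp (3 / 2) ^ 2 * (n + 1) * (n + (n + 1) * ‖θ‖ ^ 2) := by
          rw [norm_sq_eq_sum_row θ, ← Finset.sum_mul, ← Finset.mul_sum, Finset.sum_add_distrib,
            ← Finset.mul_sum]
          simp
          ring
      _ ≤ 2 * Real.exp (3 / 2) ^ 2 * (n + 1) * ((n + 1) + (n + 1) * ‖θ‖ ^ 2) := by
          gcongr
          linarith
      _ = _ := by ring
  refine ⟨2 * Real.exp (3 / 2) ^ 2 * (n + 1) ^ 2 * (2 + 2 * ‖θs‖ ^ 2), by positivity,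
    fun θ z => (key θ z).trans ?_⟩
  rw [mul_assoc _ (2 + 2 * ‖θs‖ ^ 2)]
  gcongr
  have h1 : ‖θ‖ ≤ ‖θ - θs‖ + ‖θs‖ := by simpa using norm_add_le (θ - θs) θs
  have h2 : ‖θ‖ ^ 2 ≤ (‖θ - θs‖ + ‖θs‖) ^ 2 := by gcongr
  nlinarith [sq_nonneg (‖θ - θs‖ - ‖θs‖), sq_nonneg (‖θ - θs‖ * ‖θs‖)]

/-- The probability of moving from `s` to `s'` in one step, when the true parameter is `θ`. -/
noncomputable def transProb (θ : Param n) (s s' : Obs n) : ℝ :=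
  ∏ i, bitProb ((θ.row i).gap s) (s' i)

lemma transProb_pos (θ : Param n) (s s' : Obs n) : 0 < transProb θ s s' :=
  Finset.prod_pos fun _ _ => bitProb_pos _ _

lemma sum_transProb (θ : Param n) (s : Obs n) : ∑ s', transProb θ s s' = 1 := by
  unfold transProb
  rw [← Fintype.piFinset_univ, ← Finset.prod_univ_sum]
  simp only [sum_bitProb, Finset.prod_const_one]

/-- The transition law is a product over the agents, so all coordinates other than `i` sum out to
one. -/
lemma sum_transProb_mul (θ : Param n) (s : Obs n) (i : Fin n) (f : Fin 2 → ℝ) :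
    ∑ s', transProb θ s s' * f (s' i) = ∑ b, bitProb ((θ.row i).gap s) b * f b := by
  have h : ∀ s' : Obs n, transProb θ s s' * f (s' i) =
      ∏ j, bitProb ((θ.row j).gap s) (s' j) * (if j = i then f (s' j) else 1) := by
    intro s'
    rw [Finset.prod_mul_distrib, Finset.prod_ite_eq' Finset.univ i]
    simp [transProb]
  simp only [h]
  rw [← Fintype.piFinset_univ,
    ← Finset.prod_univ_sum (fun _ => Finset.univ)
      (fun j b => bitProb ((θ.row j).gap s) b * (if j = i then f b else 1)),
    Finset.prod_eq_single i]
  · simp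
  · intro j _ hj
    simp [hj, sum_bitProb, -Fin.sum_univ_two]
  · simp

lemma exists_le_transProb (θ : Param n) : ∃ p : ℝ, 0 < p ∧ ∀ s s', p ≤ transProb θ s s' := by
  obtain ⟨x, hx⟩ := Finite.exists_min fun x : Obs n × Obs n => transProb θ x.1 x.2
  exact ⟨_, transProb_pos θ x.1 x.2, fun s t => hx (s, t)⟩

/-- The squared length of the vector of gaps at the observation `s`. -/
noncomputable def gapForm (e : Param n) (s : Obs n) : ℝ := ∑ i, (e.row i).gap s ^ 2

lemma gapForm_nonneg (e : Param n) (s : Obs n) : 0 ≤ gapForm e s :=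
  Finset.sum_nonneg fun _ _ => sq_nonneg _

lemma continuous_gapForm (s : Obs n) : Continuous fun e : Param n => gapForm e s := by
  unfold gapForm
  exact continuous_finsetSum _ fun i _ => ((continuous_gap s).comp (continuous_row i)).pow 2

lemma gapForm_le (e : Param n) (s : Obs n) : gapForm e s ≤ (n + 1) * ‖e‖ ^ 2 := by
  rw [norm_sq_eq_sum_row, Finset.mul_sum]
  exact Finset.sum_le_sum fun i _ => gap_sq_le _ _

lemma half_gapForm_le (e f : Param n) (s : Obs n) :
    gapForm e s / 2 - gapForm f s ≤ gapForm (e + f) s := by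
  unfold gapForm
  rw [Finset.sum_div, ← Finset.sum_sub_distrib]
  refine Finset.sum_le_sum fun i _ => ?_
  rw [row_add, gap_add]
  nlinarith [sq_nonneg ((e.row i).gap s + 2 * (f.row i).gap s)]

/-- The gap at the zero observation is the last coordinate of `t`, and at the `j`-th unit vector it
is the last coordinate minus the `j`-th. These `n + 1` observations already determine `t`; the
others only add squares. -/
lemma norm_sq_le_sum_gap_sq (t : RowParam n) :
    ‖t‖ ^ 2 ≤ (2 * n + 2) * ∑ s : Obs n, t.gap s ^ 2 := by
  set T := ∑ s : Obs n, t.gap s ^ 2 with hT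
  have h0 : t (Fin.last n) ^ 2 + ∑ j : Fin n, (t (Fin.last n) - t j.castSucc) ^ 2 ≤ T := by
    have hz : t.gap (fun _ => 0) = t (Fin.last n) := by simp [RowParam.gap, bit]
    have hj : ∀ j : Fin n, t.gap (Pi.single j 1) = t (Fin.last n) - t j.castSucc := by
      intro j
      simp only [RowParam.gap]
      rw [Finset.sum_eq_single j]
      · simp [bit]
      · intro k _ hk
        simp [hk, bit]
      · simp
    -- `none` indexes the zero observation and `some j` the unit vectors; injectivity makes their
    -- contribution a partial sum of `T`.
    have hinj : Function.Injective fun o : Option (Fin n) =>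
        (o.elim (fun _ => 0) (fun j => Pi.single j 1) : Obs n) := by
      rintro (_ | j) (_ | k) h
      · rfl
      · have := congrFun h k
        simp at this
      · have := congrFun h j
        simp at this
      · have := congrFun h j
        by_cases hjk : j = k
        · rw [hjk]
        · simp [hjk] at this
    have := Finset.sum_le_sum_of_subset_of_nonneg (f := fun s : Obs n => t.gap s ^ 2)
      (Finset.subset_univ (Finset.univ.map ⟨_, hinj⟩)) fun s _ _ => sq_nonneg _
    rw [Finset.sum_map, Fintype.sum_option] at this
    simpa [hz, hj] using this
  have h1 : ∑ j : Fin n, t j.castSucc ^ 2 ≤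
      2 * ∑ j : Fin n, (t (Fin.last n) - t j.castSucc) ^ 2 + 2 * n * t (Fin.last n) ^ 2 := by
    have : ∑ j : Fin n, t j.castSucc ^ 2 ≤
        ∑ j : Fin n, (2 * (t (Fin.last n) - t j.castSucc) ^ 2 + 2 * t (Fin.last n) ^ 2) :=
      Finset.sum_le_sum fun j _ => by
        nlinarith [sq_nonneg (2 * t (Fin.last n) - t j.castSucc)]
    rw [Finset.sum_add_distrib, ← Finset.mul_sum] at this
    simp at this
    linarith
  have h2 : 0 ≤ ∑ j : Fin n, (t (Fin.last n) - t j.castSucc) ^ 2 :=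
    Finset.sum_nonneg fun _ _ => sq_nonneg _
  rw [EuclideanSpace.norm_sq_eq, Fin.sum_univ_castSucc]
  simp only [Real.norm_eq_abs, sq_abs]
  nlinarith [mul_nonneg (Nat.cast_nonneg n : (0 : ℝ) ≤ n) h2, sq_nonneg (t (Fin.last n)),
    mul_le_mul_of_nonneg_left h0 (by positivity : (0 : ℝ) ≤ 2 * n + 2)]

/-- The gap forms of all observations together are positive definite. -/
lemma norm_sq_le_sum_gapForm (e : Param n) :
    ‖e‖ ^ 2 ≤ (2 * n + 2) * ∑ s : Obs n, gapForm e s := by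
  unfold gapForm
  rw [Finset.sum_comm, norm_sq_eq_sum_row, Finset.mul_sum]
  exact Finset.sum_le_sum fun i _ => norm_sq_le_sum_gap_sq _

lemma sum_transProb_mul_inner_score (θs θ : Param n) (s : Obs n) :
    ∑ s', transProb θs s s' * inner ℝ (θ - θs) (score θ (s', s)) =
      ∑ i, ((θ.row i).gap s - (θs.row i).gap s) *
        ∑ b, bitProb ((θs.row i).gap s) b * slope b ((θ.row i).gap s) := by
  simp only [inner_score, Finset.mul_sum]
  rw [Finset.sum_comm]
  refine Finset.sum_congr rfl fun i _ => ?_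
  rw [← Finset.mul_sum,
    ← sum_transProb_mul θs s i fun b => slope b ((θ.row i).gap s), Finset.mul_sum]
  refine Finset.sum_congr rfl fun s' _ => ?_
  rw [row_sub, gap_sub]
  ring

lemma sum_transProb_mul_inner_score_nonpos (θs θ : Param n) (s : Obs n) :
    ∑ s', transProb θs s s' * inner ℝ (θ - θs) (score θ (s', s)) ≤ 0 := by
  rw [sum_transProb_mul_inner_score]
  exact Finset.sum_nonpos fun i _ => mul_sum_bitProb_mul_slope_le _ _

lemma norm_row_le (θ : Param n) (i : Fin n) : ‖θ.row i‖ ≤ ‖θ‖ := by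
  refine le_of_sq_le_sq ?_ (norm_nonneg _)
  rw [norm_sq_eq_sum_row]
  exact Finset.single_le_sum (f := fun i => ‖θ.row i‖ ^ 2) (fun _ _ => sq_nonneg _)
    (Finset.mem_univ i)

/-- On bounded sets, the expected score points towards the true parameter `θs` in the directions
seen at the observation `s`. -/
lemma exists_sum_transProb_mul_inner_score_le (θs : Param n) (R : ℝ) :
    ∃ κ : ℝ, 0 < κ ∧ ∀ θ s, ‖θ - θs‖ ^ 2 ≤ R →
      ∑ s', transProb θs s s' * inner ℝ (θ - θs) (score θ (s', s)) ≤
        -(κ * gapForm (θ - θs) s) := by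
  -- A common bound for the gaps of `θ` and `θs`, with the factor `√(n + 1)` of `gap_sq_le` enlarged
  -- to `n + 1`.
  set B := (n + 1) * (√R + ‖θs‖) with hB
  have hgap : ∀ (t : Param n) (i : Fin n) s, ‖t‖ ≤ √R + ‖θs‖ → |(t.row i).gap s| ≤ B := by
    intro t i s ht
    refine abs_le_of_sq_le_sq ((gap_sq_le _ s).trans ?_) (by positivity)
    rw [hB, mul_pow]
    have := norm_row_le t i
    gcongr ?_ * ?_ ^ 2
    · nlinarith [(Nat.cast_nonneg n : (0 : ℝ) ≤ n)]
    · exact this.trans ht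
  refine ⟨stdPDF B ^ 2, pow_pos (stdPDF_pos B) 2, fun θ s h => ?_⟩
  rw [sum_transProb_mul_inner_score, gapForm, Finset.mul_sum, ← Finset.sum_neg_distrib]
  refine Finset.sum_le_sum fun i _ => ?_
  rw [row_sub, gap_sub]
  refine mul_sum_bitProb_mul_slope_le_neg (hgap θ i s ?_) (hgap θs i s ?_)
  · have := norm_add_le (θ - θs) θs
    rw [sub_add_cancel] at this
    linarith [Real.le_sqrt_of_sq_le h]
  · linarith [Real.sqrt_nonneg R]

end Score

/-! ### Independence of an enlarged family -/

section Independence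

variable {Ω ι : Type*} {mΩ : MeasurableSpace Ω} {P : Measure Ω}

/-- Adding to an independent family a σ-algebra which is independent of the whole family. -/
lemma iIndep_option_elim {m₀ : MeasurableSpace Ω} {m : ι → MeasurableSpace Ω}
    (hm : iIndep m P) (h₀ : Indep (⨆ i, m i) m₀ P) :
    iIndep (fun o : Option ι => o.elim m₀ m) P := by
  classical
  rw [iIndep_iff]
  intro s f hf
  have hsome : P (⋂ i ∈ s.eraseNone, f (some i)) = ∏ i ∈ s.eraseNone, P (f (some i)) :=
    hm.meas_biInter (S := s.eraseNone) (s := fun i => f (some i))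
      fun i hi => hf (some i) (by simpa using hi)
  have hset : ∀ t : Set Ω, t ∩ ⋂ o ∈ s.erase none, f o = t ∩ ⋂ i ∈ s.eraseNone, f (some i) := by
    intro t
    ext ω
    simp [Option.forall]
  have hprod : ∏ o ∈ s.erase none, P (f o) = ∏ i ∈ s.eraseNone, P (f (some i)) := by
    rw [← Finset.map_some_eraseNone, Finset.prod_map]
    rfl
  have hmeas : MeasurableSet[⨆ i, m i] (⋂ i ∈ s.eraseNone, f (some i)) := by
    refine Finset.measurableSet_biInter _ fun i hi => ?_
    exact le_iSup m i _ (hf (some i) (by simpa using hi))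
  by_cases hn : none ∈ s
  · rw [← Finset.insert_erase hn, Finset.prod_insert (by simp), hprod, Finset.set_biInter_insert,
      hset, Set.inter_comm, (Indep_iff _ _ _).1 h₀ _ _ hmeas (hf none hn), hsome, mul_comm]
  · have := hset Set.univ
    rw [Set.univ_inter, Set.univ_inter, Finset.erase_eq_of_notMem hn] at this
    rw [this, hsome, ← hprod, Finset.erase_eq_of_notMem hn]

end Independence

/-! ### The filtration of the system and its Markov property -/

section System

variable {n : ℕ} {Ω : Type*} [mΩ : MeasurableSpace Ω] {P : Measure Ω}
  {A : Matrix (Fin n) (Fin n) ℝ} {c : Fin n → ℝ}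
  {D : ℕ → Fin n → Ω → ℝ} {Y : ℕ → Ω → Fin n → ℝ} {S : ℕ → Ω → Obs n}

/-- The σ-algebras generated by the sources of randomness: the initial observation and the
individual disturbances. -/
abbrev sourceSigma (D : ℕ → Fin n → Ω → ℝ) (S₀ : Ω → Obs n) (o : Option (ℕ × Fin n)) :
    MeasurableSpace Ω :=
  o.elim (MeasurableSpace.comap S₀ inferInstance)
    fun p => MeasurableSpace.comap (D p.1 p.2) inferInstance

lemma sourceSigma_le {S₀ : Ω → Obs n} (hd : IsGaussianDisturbance P D S₀)
    (o : Option (ℕ × Fin n)) : sourceSigma D S₀ o ≤ mΩ := by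
  rcases o with _ | p
  · exact hd.measurable_init.comap_le
  · exact (hd.measurable_disturbance p.1 p.2).comap_le

lemma iIndep_sourceSigma {S₀ : Ω → Obs n} (hd : IsGaussianDisturbance P D S₀) :
    iIndep (sourceSigma D S₀) P := by
  refine iIndep_option_elim ((iIndepFun_iff_iIndep _ _ _).1 hd.indep) ?_
  have h := (IndepFun_iff_Indep _ _ _).1 hd.indep_init
  simpa only [MeasurableSpace.pi, MeasurableSpace.comap_iSup, MeasurableSpace.comap_comp,
    Function.comp_def] using h

/-- The indices of the sources of randomness which determine `S_0, …, S_k`. -/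
def pastSources (n k : ℕ) : Set (Option (ℕ × Fin n)) := {o | ∀ p, o = some p → p.1 < k}

/-- The filtration generated by the initial observation and the disturbances. -/
def past {S₀ : Ω → Obs n} (hd : IsGaussianDisturbance P D S₀) : Filtration ℕ mΩ where
  seq k := ⨆ o ∈ pastSources n k, sourceSigma D S₀ o
  mono' _ _ hkl := biSup_mono fun _ ho p hp => (ho p hp).trans_le hkl
  le' _ := iSup₂_le fun o _ => sourceSigma_le hd o

lemma measurable_init_past {S₀ : Ω → Obs n} (hd : IsGaussianDisturbance P D S₀) (k : ℕ) :
    Measurable[past hd k] S₀ := by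
  have h : sourceSigma D S₀ none ≤ past hd k :=
    le_biSup (sourceSigma D S₀) (show none ∈ pastSources n k by simp [pastSources])
  exact (comap_measurable S₀).mono h le_rfl

lemma measurable_disturbance_past {S₀ : Ω → Obs n} (hd : IsGaussianDisturbance P D S₀)
    {j k : ℕ} (hjk : j < k) (i : Fin n) : Measurable[past hd k] (D j i) := by
  have h : sourceSigma D S₀ (some (j, i)) ≤ past hd k :=
    le_biSup (sourceSigma D S₀) (show some (j, i) ∈ pastSources n k by
      rintro p hp
      obtain rfl := Option.some.inj hp
      exact hjk)
  exact (comap_measurable (D j i)).mono h le_rfl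

/-- The observation which follows `s` under the disturbance `d`. -/
noncomputable def nextObs (A : Matrix (Fin n) (Fin n) ℝ) (c : Fin n → ℝ) (s : Obs n)
    (d : Fin n → ℝ) : Obs n :=
  quantize (fun i => ∑ j, A i j * bit (s j) + d i) c

lemma gap_vecParam (A : Matrix (Fin n) (Fin n) ℝ) (c : Fin n → ℝ) (s : Obs n) (i : Fin n) :
    ((vecParam A c).row i).gap s = c i - ∑ j, A i j * bit (s j) := by
  simp [Param.row, RowParam.gap, vecParam, Fin.snoc_last, Fin.snoc_castSucc,
    -Fin.natCast_eq_last]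

lemma nextObs_apply (A : Matrix (Fin n) (Fin n) ℝ) (c : Fin n → ℝ) (s : Obs n) (d : Fin n → ℝ)
    (i : Fin n) :
    nextObs A c s d i = if ((vecParam A c).row i).gap s ≤ d i then 1 else 0 := by
  simp only [nextObs, quantize, gap_vecParam]
  congr 1
  rw [sub_le_iff_le_add']

lemma obs_succ {Ω : Type*} {D : ℕ → Fin n → Ω → ℝ} {Y : ℕ → Ω → Fin n → ℝ}
    {S : ℕ → Ω → Obs n} (hs : IsSystem A c D Y S) (k : ℕ) (ω : Ω) :
    S (k + 1) ω = nextObs A c (S k ω) fun i => D k i ω := by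
  rw [hs.obs]
  unfold nextObs
  congr 1
  funext i
  exact hs.state k ω i

lemma measurable_nextObs (A : Matrix (Fin n) (Fin n) ℝ) (c : Fin n → ℝ) (s : Obs n) :
    Measurable (nextObs A c s) := by
  refine measurable_pi_lambda _ fun i => ?_
  simp only [nextObs_apply]
  exact Measurable.ite (measurableSet_le measurable_const (measurable_pi_apply i))
    measurable_const measurable_const

lemma measurable_nextObs_comp {α : Type*} {m : MeasurableSpace α} {f : α → Obs n} {d : α → Fin n → ℝ}
    (hf : Measurable f) (hd : Measurable d) : Measurable fun x => nextObs A c (f x) (d x) := by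
  refine measurable_pi_lambda _ fun i => ?_
  simp only [nextObs_apply]
  have hgap : Measurable fun s : Obs n => ((vecParam A c).row i).gap s := measurable_of_finite _
  exact Measurable.ite (measurableSet_le (hgap.comp hf) ((measurable_pi_apply i).comp hd))
    measurable_const measurable_const

lemma measurable_obs_past (hs : IsSystem A c D Y S) (hd : IsGaussianDisturbance P D (S 0))
    (k : ℕ) : Measurable[past hd k] (S k) := by
  induction k with
  | zero => exact measurable_init_past hd 0
  | succ k ih =>
    have h1 : Measurable[past hd (k + 1)] (S k) := ih.mono ((past hd).mono k.le_succ) le_rfl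
    have h2 : Measurable[past hd (k + 1)] fun ω i => D k i ω :=
      @measurable_pi_lambda _ _ _ (past hd (k + 1)) _ _
        fun i => measurable_disturbance_past hd k.lt_succ_self i
    have h4 : S (k + 1) = fun ω => nextObs A c (S k ω) fun i => D k i ω :=
      funext fun ω => obs_succ hs k ω
    rw [h4]
    exact measurable_nextObs_comp h1 h2

/-- The past at time `k` uses only disturbances with time index strictly below `k`: it determines `S
k` but shares no source with `D k`. -/
lemma indep_disturbance_past {S₀ : Ω → Obs n} (hd : IsGaussianDisturbance P D S₀) (k : ℕ) :
    Indep (MeasurableSpace.comap (fun ω i => D k i ω) inferInstance) (past hd k) P := by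
  have h := indep_iSup_of_disjoint (sourceSigma_le hd) (iIndep_sourceSigma hd)
    (S := Set.range fun i : Fin n => some (k, i)) (T := pastSources n k) (by
      rw [Set.disjoint_left]
      rintro _ ⟨i, rfl⟩ h
      exact lt_irrefl k (h _ rfl))
  refine indep_of_indep_of_le_left h ?_
  simp only [MeasurableSpace.pi, MeasurableSpace.comap_iSup, MeasurableSpace.comap_comp,
    iSup_range]
  exact le_rfl

lemma measureReal_nextObs_eq [IsProbabilityMeasure P] {S₀ : Ω → Obs n}
    (hd : IsGaussianDisturbance P D S₀) (k : ℕ) (s s' : Obs n) :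
    P.real {ω | nextObs A c s (fun i => D k i ω) = s'} = transProb (vecParam A c) s s' := by
  set B : Fin n → Set ℝ := fun i => {x | (if ((vecParam A c).row i).gap s ≤ x then 1 else 0) = s' i}
  have hB : ∀ i, MeasurableSet (B i) := fun i =>
    (Measurable.ite measurableSet_Ici measurable_const measurable_const
      : Measurable fun x : ℝ => if ((vecParam A c).row i).gap s ≤ x then (1 : Fin 2) else 0)
      (measurableSet_singleton (s' i))
  have hset : {ω | nextObs A c s (fun i => D k i ω) = s'} =
      ⋂ i ∈ (Finset.univ : Finset (Fin n)), D k i ⁻¹' B i := by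
    ext ω
    simp [B, funext_iff, nextObs_apply]
  have hind : iIndepFun (fun i : Fin n => D k i) P :=
    hd.indep.precomp (g := fun i : Fin n => (k, i)) fun i j h => by simpa using h
  rw [hset, Measure.real, hind.measure_inter_preimage_eq_mul _ (fun i _ => hB i),
    ENNReal.toReal_prod, transProb]
  refine Finset.prod_congr rfl fun i _ => ?_
  rw [← Measure.map_apply (hd.measurable_disturbance k i) (hB i), hd.law]
  change (gaussianReal 0 1).real (B i) = _
  have hmem : ∀ b : Fin 2, s' i = b → B i =
      if b = 0 then Set.Iio (((vecParam A c).row i).gap s)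
      else Set.Ici (((vecParam A c).row i).gap s) := by
    intro b hb
    ext x
    fin_cases b <;> simp [B, hb]
  -- The quantizer gives `0` strictly below the threshold while `Phi` includes it; the Gaussian law
  -- has no atoms.
  have hIio : (gaussianReal 0 1).real (Set.Iio (((vecParam A c).row i).gap s)) =
      Phi (((vecParam A c).row i).gap s) := by
    have := nullSingletonClass_gaussianReal (μ := 0) (v := 1) one_ne_zero
    rw [Phi_eq_measureReal]
    exact measureReal_congr Iio_ae_eq_Iic
  rw [hmem _ rfl]
  unfold bitProb
  split_ifs
  · exact hIio
  · rw [← Set.compl_Iio, probReal_compl_eq_one_sub measurableSet_Iio, hIio]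

/-- With `s` frozen, the event depends on the fresh disturbance alone, so conditioning on the past
leaves its probability unchanged. -/
lemma condExp_nextObs [IsProbabilityMeasure P] {S₀ : Ω → Obs n}
    (hd : IsGaussianDisturbance P D S₀) (k : ℕ) (s s' : Obs n) :
    P[{ω | nextObs A c s (fun i => D k i ω) = s'}.indicator (fun _ => (1 : ℝ)) | past hd k]
      =ᵐ[P] fun _ => transProb (vecParam A c) s s' := by
  have hD : Measurable fun ω i => D k i ω :=
    measurable_pi_lambda _ fun i => hd.measurable_disturbance k i
  have hset : MeasurableSet[MeasurableSpace.comap (fun ω i => D k i ω) inferInstance]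
      {ω | nextObs A c s (fun i => D k i ω) = s'} :=
    ⟨_, measurable_nextObs A c s (measurableSet_singleton s'), rfl⟩
  have hsm : StronglyMeasurable[MeasurableSpace.comap (fun ω i => D k i ω) inferInstance]
      ({ω | nextObs A c s (fun i => D k i ω) = s'}.indicator fun _ => (1 : ℝ)) :=
    stronglyMeasurable_const.indicator hset
  have h := condExp_indep_eq hD.comap_le ((past hd).le k) hsm (indep_disturbance_past hd k)
  refine h.trans (ae_of_all _ fun _ => ?_)
  simp only [← measureReal_nextObs_eq hd k s s']
  rw [integral_indicator_const _ (hD.comap_le _ hset)]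
  simp

/-- The Markov property, for functions of the past and of the next observation. -/
lemma condExp_obs_succ [IsProbabilityMeasure P] (hs : IsSystem A c D Y S)
    (hd : IsGaussianDisturbance P D (S 0)) (k : ℕ) (G : Ω → Obs n → ℝ)
    (hG : ∀ s', StronglyMeasurable[past hd k] fun ω => G ω s')
    (hGb : ∃ C, ∀ ω s', |G ω s'| ≤ C) :
    P[fun ω => G ω (S (k + 1) ω) | past hd k] =ᵐ[P]
      fun ω => ∑ s', transProb (vecParam A c) (S k ω) s' * G ω s' := by
  obtain ⟨C, hC⟩ := hGb
  have hD : Measurable fun ω i => D k i ω :=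
    measurable_pi_lambda _ fun i => hd.measurable_disturbance k i
  set E : Obs n × Obs n → Ω → ℝ := fun x =>
    {ω | nextObs A c x.1 (fun i => D k i ω) = x.2}.indicator (fun _ => (1 : ℝ)) with hE
  set F : Obs n × Obs n → Ω → ℝ := fun x => {ω | S k ω = x.1}.indicator fun ω => G ω x.2 with hF
  have hEint : ∀ x, Integrable (E x) P := fun x =>
    (integrable_const (1 : ℝ)).indicator
      (((measurable_nextObs A c x.1).comp hD) (measurableSet_singleton x.2))
  have hFm : ∀ x, StronglyMeasurable[past hd k] (F x) := fun x =>
    (hG x.2).indicator (measurable_obs_past hs hd k (measurableSet_singleton x.1))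
  have hFE : ∀ x, Integrable (F x * E x) P := fun x => by
    refine (hEint x).bdd_mul (c := C) ((hFm x).mono ((past hd).le k)).aestronglyMeasurable
      (ae_of_all _ fun ω => ?_)
    refine (norm_indicator_le_norm_self _ _).trans ?_
    exact hC ω x.2
  -- Splitting over the finitely many values of the pair `(S k, S (k + 1))` separates a factor `F x`
  -- known from the past from a factor `E x` driven by fresh noise.
  have hsum : (fun ω => G ω (S (k + 1) ω)) = ∑ x, F x * E x := by
    funext ω
    rw [Finset.sum_apply, Finset.sum_eq_single (S k ω, S (k + 1) ω)]
    · simp [hF, hE, obs_succ hs k ω]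
    · rintro ⟨s, s'⟩ - hne
      by_cases h1 : S k ω = s
      · have h2 : ¬ nextObs A c s (fun i => D k i ω) = s' := by
          rintro rfl
          apply hne
          rw [obs_succ hs k ω, h1]
        simp [hE, h2]
      · simp [hF, h1]
    · simp
  rw [hsum]
  have h1 := condExp_finsetSum (μ := P) (s := Finset.univ) (fun x _ => hFE x) (past hd k)
  have h2 : ∀ᵐ ω ∂P, ∀ x, (P[F x * E x | past hd k]) ω =
      F x ω * transProb (vecParam A c) x.1 x.2 := by
    rw [ae_all_iff]
    intro x
    filter_upwards [condExp_mul_of_stronglyMeasurable_left (hFm x) (hFE x) (hEint x),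
      condExp_nextObs (A := A) (c := c) hd k x.1 x.2] with ω h3 h4
    rw [h3, Pi.mul_apply, h4]
  filter_upwards [h1, h2] with ω h1 h2
  rw [h1, Finset.sum_apply]
  simp only [h2, Fintype.sum_prod_type]
  rw [Finset.sum_eq_single (S k ω)]
  · exact Finset.sum_congr rfl fun s' _ => by simp [hF, mul_comm]
  · intro s _ hne
    exact Finset.sum_eq_zero fun s' _ => by simp [hF, hne.symm]
  · simp

end System

/-! ### Almost sure bounds for nonnegative almost-supermartingales -/

section Supermartingale

variable {Ω : Type*} {mΩ : MeasurableSpace Ω} {P : Measure Ω}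

/-- The L¹ norm of a nonnegative supermartingale is its mean, which does not increase; hence the
submartingale `-g` converges almost surely. -/
lemma ae_bddAbove_of_supermartingale [IsFiniteMeasure P] {ℱ : Filtration ℕ mΩ} {g : ℕ → Ω → ℝ}
    (hg : Supermartingale g ℱ P) (hpos : ∀ k ω, 0 ≤ g k ω) :
    ∀ᵐ ω ∂P, BddAbove (Set.range fun k => g k ω) := by
  have hnorm : ∀ k, eLpNorm ((-g) k) 1 P ≤ (∫ ω, g 0 ω ∂P).toNNReal := by
    intro k
    rw [Pi.neg_apply, eLpNorm_neg, eLpNorm_one_eq_lintegral_enorm,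
      ← ofReal_integral_norm_eq_lintegral_enorm (hg.integrable k)]
    refine ENNReal.ofReal_le_ofReal ?_
    calc ∫ ω, ‖g k ω‖ ∂P = ∫ ω, g k ω ∂P := by
          simp only [Real.norm_eq_abs, abs_of_nonneg (hpos k _)]
      _ ≤ ∫ ω, g 0 ω ∂P := by
          simpa using hg.setIntegral_le (Nat.zero_le k) (MeasurableSet.univ (α := Ω))
  filter_upwards [hg.neg.exists_ae_tendsto_of_bdd hnorm] with ω ⟨x, hx⟩
  simpa using hx.neg.bddAbove_range

/-- A nonnegative process which is a supermartingale up to a summable error is almost surely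
bounded. -/
lemma ae_exists_le_of_condExp_le [IsFiniteMeasure P] {ℱ : Filtration ℕ mΩ} {f : ℕ → Ω → ℝ}
    {ε : ℕ → ℝ} (k₀ : ℕ) (hadp : ∀ k, StronglyMeasurable[ℱ k] (f k))
    (hint : ∀ k, Integrable (f k) P) (hpos : ∀ k ≥ k₀, ∀ ω, 0 ≤ f k ω)
    (hε : ∀ k, 0 ≤ ε k) (hsum : Summable ε)
    (hle : ∀ k ≥ k₀, ∀ᵐ ω ∂P, (P[f (k + 1) | ℱ k]) ω ≤ f k ω + ε k) :
    ∀ᵐ ω ∂P, ∃ C, ∀ k ≥ k₀, f k ω ≤ C := by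
  -- Adding the tail of the error series turns the process into a true supermartingale.
  set T : ℕ → ℝ := fun k => ∑' j, ε j - ∑ j ∈ Finset.range k, ε j with hT
  have hT0 : ∀ k, 0 ≤ T k := fun k =>
    sub_nonneg.2 (hsum.sum_le_tsum _ fun j _ => hε j)
  have hTs : ∀ k, T (k + 1) = T k - ε k := fun k => by
    simp only [hT, Finset.sum_range_succ]
    ring
  -- Positivity and drift are available only from time `k₀`, so time is shifted.
  let 𝒢 : Filtration ℕ mΩ :=
    ⟨fun k => ℱ (k₀ + k), fun i j hij => ℱ.mono (by omega), fun k => ℱ.le _⟩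
  have hsup : Supermartingale (fun k ω => f (k₀ + k) ω + T (k₀ + k)) 𝒢 P := by
    refine supermartingale_nat (fun k => (hadp (k₀ + k)).add stronglyMeasurable_const)
      (fun k => (hint _).add (integrable_const _)) fun k => ?_
    have h1 : P[fun ω => f (k₀ + (k + 1)) ω + T (k₀ + (k + 1)) | ℱ (k₀ + k)] =ᵐ[P]
        P[f (k₀ + k + 1) | ℱ (k₀ + k)] + P[fun _ => T (k₀ + k + 1) | ℱ (k₀ + k)] :=
      condExp_add (hint (k₀ + k + 1)) (integrable_const _) _
    filter_upwards [h1, hle (k₀ + k) (by omega)] with ω h1 h2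
    refine h1.trans_le ?_
    rw [condExp_const (ℱ.le _), Pi.add_apply, hTs]
    linarith
  filter_upwards [ae_bddAbove_of_supermartingale hsup
    fun k ω => add_nonneg (hpos _ (by omega) ω) (hT0 _)] with ω ⟨C, hC⟩
  refine ⟨C, fun k hk => ?_⟩
  have h := hC ⟨k - k₀, rfl⟩
  simp only [Nat.add_sub_cancel' hk] at h
  linarith [hT0 k]

end Supermartingale

/-! ### Measurability, integrability and conditional means of the estimates -/

section Estimate

variable {n : ℕ} {Ω : Type*} [mΩ : MeasurableSpace Ω] {P : Measure Ω}
  {A : Matrix (Fin n) (Fin n) ℝ} {c : Fin n → ℝ}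
  {D : ℕ → Fin n → Ω → ℝ} {Y : ℕ → Ω → Fin n → ℝ} {S : ℕ → Ω → Obs n}

/-- One step of the algorithm. -/
noncomputable def update (α : ℝ) (θ : Param n) (z : Obs n × Obs n) : Param n :=
  θ + α • score θ z

lemma estimate_succ (step : ℕ → ℝ) (θ₀ : Param n) (s : ℕ → Obs n) (k : ℕ) :
    estimate step θ₀ s (k + 1) =
      update (step k) (estimate step θ₀ s k) (s (k + 1), s k) := rfl

lemma measurable_update (α : ℝ) :
    Measurable fun x : Param n × (Obs n × Obs n) => update α x.1 x.2 :=
  measurable_from_prod_countable_left fun z =>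
    (continuous_id.add ((continuous_score z).const_smul α)).measurable

lemma measurable_estimate_past (hs : IsSystem A c D Y S) (hd : IsGaussianDisturbance P D (S 0))
    (step : ℕ → ℝ) (θ₀ : Param n) (k : ℕ) :
    Measurable[past hd k] fun ω => estimate step θ₀ (fun m => S m ω) k := by
  induction k with
  | zero => exact measurable_const
  | succ k ih =>
    have h1 := ih.mono ((past hd).mono k.le_succ) le_rfl
    have h2 := (measurable_obs_past hs hd k).mono ((past hd).mono k.le_succ) le_rfl
    simp only [estimate_succ]
    exact (measurable_update (step k)).comp
      (h1.prodMk ((measurable_obs_past hs hd (k + 1)).prodMk h2))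

lemma exists_norm_update_le (α : ℝ) (r : ℝ) :
    ∃ C, ∀ (θ : Param n) z, ‖θ‖ ≤ r → ‖update α θ z‖ ≤ C := by
  obtain ⟨K, hK0, hK⟩ := exists_norm_score_sq_le (0 : Param n)
  refine ⟨r + |α| * √(K * (1 + r ^ 2)), fun θ z h => ?_⟩
  refine (norm_add_le _ _).trans ?_
  rw [norm_smul, Real.norm_eq_abs]
  gcongr
  refine Real.le_sqrt_of_sq_le ((hK θ z).trans ?_)
  rw [sub_zero]
  gcongr

/-- For fixed `k` the bound is uniform over all paths, so continuous functions of the estimate are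
bounded and integrability is automatic. -/
lemma exists_norm_estimate_le (step : ℕ → ℝ) (θ₀ : Param n) (k : ℕ) :
    ∃ C, ∀ s : ℕ → Obs n, ‖estimate step θ₀ s k‖ ≤ C := by
  induction k with
  | zero => exact ⟨‖θ₀‖, fun _ => le_rfl⟩
  | succ k ih =>
    obtain ⟨r, hr⟩ := ih
    obtain ⟨C, hC⟩ := exists_norm_update_le (n := n) (step k) r
    exact ⟨C, fun s => hC _ _ (hr s)⟩

lemma exists_abs_le_of_continuous {g : Param n → Obs n → ℝ} (hg : ∀ s, Continuous fun θ => g θ s)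
    (r : ℝ) : ∃ C, ∀ θ s, ‖θ‖ ≤ r → |g θ s| ≤ C := by
  choose C hC using fun s => (isCompact_closedBall (0 : Param n) r).exists_bound_of_continuousOn
    (hg s).continuousOn
  obtain ⟨M, hM⟩ := (Set.finite_range C).bddAbove
  exact ⟨M, fun θ s h => (hC s θ (by simpa using h)).trans (hM ⟨s, rfl⟩)⟩

lemma measurable_comp_prod {α : Type*} {m : MeasurableSpace α} {g : Param n → Obs n → ℝ}
    (hg : ∀ s, Continuous fun θ => g θ s) {f : α → Param n} {h : α → Obs n}
    (hf : Measurable f) (hh : Measurable h) : Measurable fun x => g (f x) (h x) := by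
  have : Measurable fun x : Param n × Obs n => g x.1 x.2 :=
    measurable_from_prod_countable_left fun s => (hg s).measurable
  exact this.comp (hf.prodMk hh)

lemma integrable_estimate [IsFiniteMeasure P] (hs : IsSystem A c D Y S)
    (hd : IsGaussianDisturbance P D (S 0)) (step : ℕ → ℝ) (θ₀ : Param n) (k : ℕ)
    {g : Param n → Obs n → ℝ} (hg : ∀ s, Continuous fun θ => g θ s) :
    Integrable (fun ω => g (estimate step θ₀ (fun m => S m ω) k) (S k ω)) P := by
  obtain ⟨r, hr⟩ := exists_norm_estimate_le step θ₀ k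
  obtain ⟨C, hC⟩ := exists_abs_le_of_continuous hg r
  refine Integrable.of_bound (C := C) ?_ (ae_of_all _ fun ω => hC _ _ (hr _))
  exact ((measurable_comp_prod hg (measurable_estimate_past hs hd step θ₀ k)
    (measurable_obs_past hs hd k)).mono ((past hd).le k) le_rfl).aestronglyMeasurable

/-- The conditional expectation of a function of the next estimate and observation, on an event
of the past. -/
lemma condExp_indicator_estimate_succ [IsProbabilityMeasure P] (hs : IsSystem A c D Y S)
    (hd : IsGaussianDisturbance P D (S 0)) (step : ℕ → ℝ) (θ₀ : Param n) (k : ℕ)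
    {g : Param n → Obs n → ℝ} (hg : ∀ s, Continuous fun θ => g θ s) {E : Set Ω}
    (hE : MeasurableSet[past hd k] E) :
    P[E.indicator fun ω => g (estimate step θ₀ (fun m => S m ω) (k + 1)) (S (k + 1) ω) |
        past hd k] =ᵐ[P]
      E.indicator fun ω => ∑ s', transProb (vecParam A c) (S k ω) s' *
        g (update (step k) (estimate step θ₀ (fun m => S m ω) k) (s', S k ω)) s' := by
  obtain ⟨r, hr⟩ := exists_norm_estimate_le step θ₀ k
  obtain ⟨r', hr'⟩ := exists_norm_update_le (n := n) (step k) r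
  obtain ⟨C, hC⟩ := exists_abs_le_of_continuous hg r'
  set G : Ω → Obs n → ℝ := fun ω s' => E.indicator (fun ω =>
    g (update (step k) (estimate step θ₀ (fun m => S m ω) k) (s', S k ω)) s') ω with hG
  have hGm : ∀ s', StronglyMeasurable[past hd k] fun ω => G ω s' := by
    intro s'
    refine StronglyMeasurable.indicator ?_ hE
    refine Measurable.stronglyMeasurable ?_
    exact (hg s').measurable.comp ((measurable_update (step k)).comp
      ((measurable_estimate_past hs hd step θ₀ k).prodMk
        (measurable_const.prodMk (measurable_obs_past hs hd k))))
  have hGb : ∀ ω s', |G ω s'| ≤ C := fun ω s' =>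
    (norm_indicator_le_norm_self (s := E) (fun ω =>
      g (update (step k) (estimate step θ₀ (fun m => S m ω) k) (s', S k ω)) s') ω).trans
      (hC _ _ (hr' _ _ (hr _)))
  have h := condExp_obs_succ hs hd k G hGm ⟨C, hGb⟩
  have h1 : (fun ω => G ω (S (k + 1) ω)) =
      E.indicator fun ω => g (estimate step θ₀ (fun m => S m ω) (k + 1)) (S (k + 1) ω) := by
    funext ω
    by_cases hω : ω ∈ E <;> simp [hG, hω, estimate_succ]
  have h2 : (fun ω => ∑ s', transProb (vecParam A c) (S k ω) s' * G ω s') =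
      E.indicator fun ω => ∑ s', transProb (vecParam A c) (S k ω) s' *
        g (update (step k) (estimate step θ₀ (fun m => S m ω) k) (s', S k ω)) s' := by
    funext ω
    by_cases hω : ω ∈ E <;> simp [hG, hω]
  rwa [h1, h2] at h

end Estimate

/-! ### One-step drift of the squared error and of the Lyapunov function -/

section Drift

variable {n : ℕ}

lemma norm_update_sub_sq (α : ℝ) (θs θ : Param n) (z : Obs n × Obs n) :
    ‖update α θ z - θs‖ ^ 2 =
      ‖θ - θs‖ ^ 2 + 2 * α * inner ℝ (θ - θs) (score θ z) + α ^ 2 * ‖score θ z‖ ^ 2 := by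
  rw [update, add_sub_right_comm, norm_add_sq_real, real_inner_smul_right, norm_smul, mul_pow,
    Real.norm_eq_abs, sq_abs]
  ring

lemma sum_transProb_mul_le (θs : Param n) (s : Obs n) {f : Obs n → ℝ} {C : ℝ}
    (h : ∀ s', f s' ≤ C) : ∑ s', transProb θs s s' * f s' ≤ C := by
  calc ∑ s', transProb θs s s' * f s' ≤ ∑ s', transProb θs s s' * C :=
        Finset.sum_le_sum fun s' _ => mul_le_mul_of_nonneg_left (h s') (transProb_pos _ _ _).le
    _ = C := by rw [← Finset.sum_mul, sum_transProb, one_mul]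

lemma sum_transProb_mul_norm_update_sq_le {θs θ : Param n} {α C : ℝ} (s : Obs n)
    (hC : ∀ z, ‖score θ z‖ ^ 2 ≤ C) :
    ∑ s', transProb θs s s' * ‖update α θ (s', s) - θs‖ ^ 2 ≤
      ‖θ - θs‖ ^ 2 + 2 * α * (∑ s', transProb θs s s' * inner ℝ (θ - θs) (score θ (s', s)))
        + α ^ 2 * C := by
  have h : ∑ s', transProb θs s s' * ‖score θ (s', s)‖ ^ 2 ≤ C :=
    sum_transProb_mul_le θs s fun s' => hC _
  have h1 : ∑ s', transProb θs s s' * ‖update α θ (s', s) - θs‖ ^ 2 =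
      ‖θ - θs‖ ^ 2 + 2 * α * (∑ s', transProb θs s s' * inner ℝ (θ - θs) (score θ (s', s)))
        + α ^ 2 * ∑ s', transProb θs s s' * ‖score θ (s', s)‖ ^ 2 := by
    have h2 : ‖θ - θs‖ ^ 2 = ∑ s', transProb θs s s' * ‖θ - θs‖ ^ 2 := by
      rw [← Finset.sum_mul, sum_transProb, one_mul]
    rw [h2, Finset.mul_sum, Finset.mul_sum, ← Finset.sum_add_distrib, ← Finset.sum_add_distrib]
    refine Finset.sum_congr rfl fun s' _ => ?_
    rw [norm_update_sub_sq]
    ring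
  rw [h1]
  gcongr

/-- The squared error, corrected by the expected decrease in the next step. -/
noncomputable def lyapunov (κ α : ℝ) (θs θ : Param n) (s : Obs n) : ℝ :=
  ‖θ - θs‖ ^ 2 - 2 * α * κ * gapForm (θ - θs) s

lemma continuous_lyapunov (κ α : ℝ) (θs : Param n) (s : Obs n) :
    Continuous fun θ => lyapunov κ α θs θ s := by
  unfold lyapunov
  have := (continuous_gapForm s).comp (continuous_id.sub (continuous_const (y := θs)))
  exact ((continuous_id.sub continuous_const).norm.pow 2).sub (continuous_const.mul this)

lemma half_norm_sq_le_lyapunov {κ α : ℝ} (hκ : 0 ≤ κ) (hα : 0 ≤ α)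
    (h : 4 * α * κ * (n + 1) ≤ 1) (θs θ : Param n) (s : Obs n) :
    ‖θ - θs‖ ^ 2 / 2 ≤ lyapunov κ α θs θ s := by
  unfold lyapunov
  have h1 := mul_le_mul_of_nonneg_left (gapForm_le (θ - θs) s) (by positivity : 0 ≤ 2 * α * κ)
  nlinarith [sq_nonneg ‖θ - θs‖]

lemma lyapunov_le {κ α : ℝ} (hκ : 0 ≤ κ) (hα : 0 ≤ α) (θs θ : Param n) (s : Obs n) :
    lyapunov κ α θs θ s ≤ ‖θ - θs‖ ^ 2 := by
  unfold lyapunov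
  have := mul_nonneg (by positivity : 0 ≤ 2 * α * κ) (gapForm_nonneg (θ - θs) s)
  linarith

/-- Every next observation has probability at least `p`, so the averaged gap form dominates the full
norm by `norm_sq_le_sum_gapForm`. Replacing the updated error by the old one costs a factor `1 / 2`
and a term of order `α ^ 2`. -/
lemma le_sum_transProb_mul_gapForm_update {θs θ : Param n} {α C p : ℝ} (s : Obs n)
    (hp0 : 0 ≤ p) (hp : ∀ s s', p ≤ transProb θs s s') (hC : ∀ z, ‖score θ z‖ ^ 2 ≤ C) :
    p * ‖θ - θs‖ ^ 2 / (2 * (2 * n + 2)) - (n + 1) * (α ^ 2 * C) ≤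
      ∑ s', transProb θs s s' * gapForm (update α θ (s', s) - θs) s' := by
  have h1 : ∀ s', gapForm (θ - θs) s' / 2 - (n + 1) * (α ^ 2 * C) ≤
      gapForm (update α θ (s', s) - θs) s' := by
    intro s'
    have h := half_gapForm_le (θ - θs) (α • score θ (s', s)) s'
    have h2 : gapForm (α • score θ (s', s)) s' ≤ (n + 1) * (α ^ 2 * C) := by
      refine (gapForm_le _ _).trans ?_
      rw [norm_smul, mul_pow, Real.norm_eq_abs, sq_abs]
      gcongr
      exact hC _
    rw [update, add_sub_right_comm]
    linarith
  have h3 : p * ‖θ - θs‖ ^ 2 / (2 * (2 * n + 2)) ≤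
      ∑ s', transProb θs s s' * (gapForm (θ - θs) s' / 2) := by
    calc p * ‖θ - θs‖ ^ 2 / (2 * (2 * n + 2))
        ≤ p * ((2 * n + 2) * ∑ s' : Obs n, gapForm (θ - θs) s') / (2 * (2 * n + 2)) := by
          gcongr
          exact norm_sq_le_sum_gapForm _
      _ = ∑ s' : Obs n, p * (gapForm (θ - θs) s' / 2) := by
          rw [← Finset.mul_sum, ← Finset.sum_div]
          field_simp
      _ ≤ _ := Finset.sum_le_sum fun s' _ => mul_le_mul_of_nonneg_right (hp s s')
          (div_nonneg (gapForm_nonneg _ _) two_pos.le)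
  calc _ ≤ ∑ s', transProb θs s s' * (gapForm (θ - θs) s' / 2) - (n + 1) * (α ^ 2 * C) := by
        gcongr
    _ = ∑ s', transProb θs s s' * (gapForm (θ - θs) s' / 2 - (n + 1) * (α ^ 2 * C)) := by
        simp only [mul_sub, Finset.sum_sub_distrib, ← Finset.sum_mul, sum_transProb]
        ring
    _ ≤ _ := Finset.sum_le_sum fun s' _ => mul_le_mul_of_nonneg_left (h1 s')
          (transProb_pos _ _ _).le

/-- The drift at `s` is exactly the correction contained in `lyapunov κ α`, so the mean new squared
error is at most this value plus `α ^ 2 * C`. The correction at the next observation, averaged,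
supplies the contraction in the full norm. Its own error is at most another `α ^ 2 * C` because `α'`
is small. -/
lemma sum_transProb_mul_lyapunov_update_le {θs θ : Param n} {α α' C p κ : ℝ} (s : Obs n)
    (hα : 0 ≤ α) (hα' : 0 ≤ α') (hκ : 0 ≤ κ) (hsmall : 4 * α' * κ * (n + 1) ≤ 1)
    (hp0 : 0 ≤ p) (hp : ∀ s s', p ≤ transProb θs s s') (hC : ∀ z, ‖score θ z‖ ^ 2 ≤ C)
    (hdrift : ∑ s', transProb θs s s' * inner ℝ (θ - θs) (score θ (s', s)) ≤
      -(κ * gapForm (θ - θs) s)) :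
    ∑ s', transProb θs s s' * lyapunov κ α' θs (update α θ (s', s)) s' ≤
      (1 - κ * p / (2 * n + 2) * α') * lyapunov κ α θs θ s + 2 * C * α ^ 2 := by
  have hC0 : 0 ≤ C := (sq_nonneg _).trans (hC (s, s))
  have h1 := sum_transProb_mul_norm_update_sq_le (θs := θs) (α := α) s hC
  have h2 := le_sum_transProb_mul_gapForm_update (α := α) s hp0 hp hC
  have h3 : ∑ s', transProb θs s s' * lyapunov κ α' θs (update α θ (s', s)) s' =
      ∑ s', transProb θs s s' * ‖update α θ (s', s) - θs‖ ^ 2 -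
        2 * α' * κ * ∑ s', transProb θs s s' * gapForm (update α θ (s', s) - θs) s' := by
    rw [Finset.mul_sum, ← Finset.sum_sub_distrib]
    refine Finset.sum_congr rfl fun s' _ => ?_
    rw [lyapunov]
    ring
  have h4 := mul_le_mul_of_nonneg_left h2 (by positivity : 0 ≤ 2 * α' * κ)
  have h5 := mul_le_mul_of_nonneg_left hdrift (by positivity : 0 ≤ 2 * α)
  have h6 := mul_le_mul_of_nonneg_left (lyapunov_le hκ hα θs θ s)
    (by positivity : 0 ≤ κ * p / (2 * n + 2) * α')
  have h7 : 2 * α' * κ * (p * ‖θ - θs‖ ^ 2 / (2 * (2 * n + 2))) =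
      κ * p / (2 * n + 2) * α' * ‖θ - θs‖ ^ 2 := by
    field_simp
  have h8 : 2 * α' * κ * ((n + 1) * (α ^ 2 * C)) ≤ α ^ 2 * C := by
    have : 0 ≤ α ^ 2 * C := by positivity
    nlinarith
  have h9 : ‖θ - θs‖ ^ 2 - 2 * α * (κ * gapForm (θ - θs) s) = lyapunov κ α θs θ s := by
    rw [lyapunov]
    ring
  rw [h3]
  rw [mul_sub, h7] at h4
  linarith

end Drift

/-! ### Almost sure boundedness and weighted bounds -/

section Convergence

variable {n : ℕ} {Ω : Type*} [mΩ : MeasurableSpace Ω] {P : Measure Ω}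
  {A : Matrix (Fin n) (Fin n) ℝ} {c : Fin n → ℝ}
  {D : ℕ → Fin n → Ω → ℝ} {Y : ℕ → Ω → Fin n → ℝ} {S : ℕ → Ω → Obs n}

/-- The squared estimation error after `k` steps. -/
noncomputable def sqError (θs : Param n) (step : ℕ → ℝ) (θ₀ : Param n) (s : ℕ → Obs n) (k : ℕ) :
    ℝ :=
  ‖estimate step θ₀ s k - θs‖ ^ 2

/-- The estimates are almost surely bounded. -/
lemma ae_exists_sqError_le [IsProbabilityMeasure P] (hs : IsSystem A c D Y S)
    (hd : IsGaussianDisturbance P D (S 0)) {step : ℕ → ℝ} (hstep : ∀ k, 0 ≤ step k)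
    (hsum : Summable fun k => step k ^ 2) (θ₀ : Param n) :
    ∀ᵐ ω ∂P, ∃ R, ∀ k, sqError (vecParam A c) step θ₀ (fun m => S m ω) k ≤ R := by
  set θs := vecParam A c
  obtain ⟨C, hC0, hC⟩ := exists_norm_score_sq_le θs
  -- In conditional mean, `1 + ‖θ - θs‖ ^ 2` grows at most by the factor `1 + C * step k ^ 2`. The
  -- discount `b` absorbs this and stays away from zero, since the squared steps are summable.
  set b : ℕ → ℝ := fun k => Real.exp (-(C * ∑ j ∈ Finset.range k, step j ^ 2))
  have hb : ∀ k, 0 < b k := fun k => Real.exp_pos _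
  have hbs : ∀ k, b (k + 1) * (1 + C * step k ^ 2) ≤ b k := by
    intro k
    have h1 : b k = b (k + 1) * Real.exp (C * step k ^ 2) := by
      simp only [b, ← Real.exp_add, Finset.sum_range_succ]
      congr 1
      ring
    rw [h1]
    gcongr
    linarith [Real.add_one_le_exp (C * step k ^ 2)]
  set g : ℕ → Param n → Obs n → ℝ := fun k θ _ => b k * (1 + ‖θ - θs‖ ^ 2)
  have hg : ∀ k s, Continuous fun θ => g k θ s := fun k s => by
    simp only [g]
    fun_prop
  have hg0 : ∀ k θ s, 0 ≤ g k θ s := fun k θ s => by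
    have := hb k
    simp only [g]
    positivity
  have key : ∀ᵐ ω ∂P, ∃ M, ∀ k ≥ 0,
      g k (estimate step θ₀ (fun m => S m ω) k) (S k ω) ≤ M := by
    refine ae_exists_le_of_condExp_le (ℱ := past hd) (ε := fun _ => 0) 0
      (f := fun k ω => g k (estimate step θ₀ (fun m => S m ω) k) (S k ω))
      (fun k => (measurable_comp_prod (hg k) (measurable_estimate_past hs hd step θ₀ k)
        (measurable_obs_past hs hd k)).stronglyMeasurable)
      (fun k => integrable_estimate hs hd step θ₀ k (hg k)) (fun k _ ω => hg0 k _ (S k ω))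
      (fun _ => le_rfl) summable_zero fun k _ => ?_
    have h := condExp_indicator_estimate_succ hs hd step θ₀ k (hg (k + 1)) MeasurableSet.univ
    simp only [Set.indicator_univ] at h
    filter_upwards [h] with ω hω
    rw [hω, add_zero]
    generalize estimate step θ₀ (fun m => S m ω) k = θ
    generalize S k ω = s
    have h1 := sum_transProb_mul_norm_update_sq_le (θs := θs) (α := step k) s (hC θ)
    have h2 := mul_nonpos_of_nonneg_of_nonpos (mul_nonneg two_pos.le (hstep k))
      (sum_transProb_mul_inner_score_nonpos θs θ s)
    calc ∑ s', transProb θs s s' * g (k + 1) (update (step k) θ (s', s)) s'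
        = b (k + 1) * (1 + ∑ s', transProb θs s s' * ‖update (step k) θ (s', s) - θs‖ ^ 2) := by
          simp only [g, mul_left_comm _ (b (k + 1)), ← Finset.mul_sum]
          simp only [mul_add, mul_one, Finset.sum_add_distrib, sum_transProb]
      _ ≤ b (k + 1) * ((1 + C * step k ^ 2) * (1 + ‖θ - θs‖ ^ 2)) := by
          refine mul_le_mul_of_nonneg_left ?_ (hb _).le
          linarith
      _ ≤ b k * (1 + ‖θ - θs‖ ^ 2) := by
          rw [← mul_assoc]
          gcongr
          exact hbs k
  filter_upwards [key] with ω ⟨M, hM⟩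
  set B := Real.exp (-(C * ∑' j, step j ^ 2)) with hB
  refine ⟨M / B, fun k => ?_⟩
  have hBk : B ≤ b k := by
    refine Real.exp_le_exp.2 (neg_le_neg (mul_le_mul_of_nonneg_left ?_ hC0.le))
    exact hsum.sum_le_tsum _ fun j _ => sq_nonneg _
  rw [le_div_iff₀ (Real.exp_pos _)]
  have h1 := hM k (Nat.zero_le k)
  have h2 : 0 ≤ sqError θs step θ₀ (fun m => S m ω) k := sq_nonneg _
  have h3 : b k * (1 + sqError θs step θ₀ (fun m => S m ω) k) ≤ M := h1
  nlinarith [hb k, mul_le_mul_of_nonneg_left hBk h2]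

lemma measurable_sqError_past (hs : IsSystem A c D Y S) (hd : IsGaussianDisturbance P D (S 0))
    (θs : Param n) (step : ℕ → ℝ) (θ₀ : Param n) (k : ℕ) :
    Measurable[past hd k] fun ω => sqError θs step θ₀ (fun m => S m ω) k :=
  (by fun_prop : Continuous fun θ : Param n => ‖θ - θs‖ ^ 2).measurable.comp
    (measurable_estimate_past hs hd step θ₀ k)

/-- The weighted squared errors are almost surely bounded on the event that the squared errors
are eventually at most `R`, if the weights grow more slowly than the mean error decreases. -/
theorem exists_ae_weighted_sqError_le (A : Matrix (Fin n) (Fin n) ℝ) (c : Fin n → ℝ) (R : ℝ) :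
    ∃ ρ : ℝ, 0 < ρ ∧ ∀ step w : ℕ → ℝ, (∀ k, 0 ≤ step k) → Tendsto step atTop (nhds 0) →
      (∀ k, 0 ≤ w k) → (∀ᶠ k in atTop, w (k + 1) * (1 - ρ * step (k + 1)) ≤ w k) →
      (Summable fun k => w (k + 1) * step k ^ 2) →
      ∀ (Ω : Type u) [MeasurableSpace Ω] (P : Measure Ω) [IsProbabilityMeasure P]
        (D : ℕ → Fin n → Ω → ℝ) (Y : ℕ → Ω → Fin n → ℝ) (S : ℕ → Ω → Obs n),
        IsSystem A c D Y S → IsGaussianDisturbance P D (S 0) → ∀ θ₀ : Param n, ∀ᵐ ω ∂P,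
          (∀ᶠ k in atTop, sqError (vecParam A c) step θ₀ (fun m => S m ω) k ≤ R) →
          ∃ M, ∀ᶠ k in atTop, w k * sqError (vecParam A c) step θ₀ (fun m => S m ω) k ≤ M := by
  set θs := vecParam A c
  obtain ⟨C, hC0, hC⟩ := exists_norm_score_sq_le θs
  obtain ⟨κ, hκ, hdrift⟩ := exists_sum_transProb_mul_inner_score_le θs R
  obtain ⟨p, hp0, hp⟩ := exists_le_transProb θs
  -- Built from `A`, `c` and `R` alone, before steps, weights and probability space appear; this is
  -- what frees the final exponent from `γ` and `θ₀`.
  refine ⟨κ * p / (2 * n + 2), by positivity, ?_⟩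
  intro step w hstep hstep0 hw hweight hsum Ω _ P _ D Y S hs hd θ₀
  have hsmall : ∀ᶠ k in atTop, 4 * step k * κ * (n + 1) ≤ 1 := by
    have h : Tendsto (fun k => 4 * step k * κ * (n + 1)) atTop (nhds (4 * 0 * κ * (n + 1))) :=
      ((hstep0.const_mul 4).mul_const κ).mul_const _
    exact h.eventually (ge_mem_nhds (by simp))
  obtain ⟨K, hK⟩ := eventually_atTop.1 (hweight.and hsmall)
  have hR : 0 ≤ C * (1 + |R|) := by positivity
  have key : ∀ k₀ ≥ K, ∀ᵐ ω ∂P, (∀ k ≥ k₀, sqError θs step θ₀ (fun m => S m ω) k ≤ R) →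
      ∃ M, ∀ k ≥ k₀, w k * sqError θs step θ₀ (fun m => S m ω) k ≤ M := by
    intro k₀ hk₀
    -- The constant `κ` is valid only while the squared error is at most `R`. The process is killed
    -- when this first fails after `k₀`, an event known at time `k`.
    set E : ℕ → Set Ω := fun k =>
      {ω | ∀ j ∈ Finset.Icc k₀ k, sqError θs step θ₀ (fun m => S m ω) j ≤ R} with hE
    have hEm : ∀ k, MeasurableSet[past hd k] (E k) := by
      intro k
      have : E k = ⋂ j ∈ Finset.Icc k₀ k, {ω | sqError θs step θ₀ (fun m => S m ω) j ≤ R} := by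
        ext ω
        simp [hE]
      rw [this]
      refine Finset.measurableSet_biInter _ fun j hj => ?_
      exact (past hd).mono (Finset.mem_Icc.1 hj).2 _
        (measurable_sqError_past hs hd θs step θ₀ j measurableSet_Iic)
    have hEs : ∀ k, E (k + 1) ⊆ E k := fun k ω hω j hj =>
      hω j (Finset.Icc_subset_Icc le_rfl k.le_succ hj)
    set g : ℕ → Param n → Obs n → ℝ := fun k θ s => w k * lyapunov κ (step k) θs θ s
    have hg : ∀ k s, Continuous fun θ => g k θ s := fun k s =>
      continuous_const.mul (continuous_lyapunov _ _ _ _)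
    have hg0 : ∀ k ≥ k₀, ∀ θ s, w k * (‖θ - θs‖ ^ 2 / 2) ≤ g k θ s := fun k hk θ s =>
      mul_le_mul_of_nonneg_left (half_norm_sq_le_lyapunov hκ.le (hstep k)
        (hK k (hk₀.trans hk)).2 θs θ s) (hw k)
    have hg1 : ∀ k ≥ k₀, ∀ θ s, 0 ≤ g k θ s := fun k hk θ s =>
      (mul_nonneg (hw k) (by positivity)).trans (hg0 k hk θ s)
    set F : ℕ → Ω → ℝ := fun k ω => g k (estimate step θ₀ (fun m => S m ω) k) (S k ω) with hF
    have hFm : ∀ k, StronglyMeasurable[past hd k] (F k) := fun k =>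
      (measurable_comp_prod (hg k) (measurable_estimate_past hs hd step θ₀ k)
        (measurable_obs_past hs hd k)).stronglyMeasurable
    have hFi : ∀ k, Integrable (F k) P := fun k => integrable_estimate hs hd step θ₀ k (hg k)
    have hbdd : ∀ᵐ ω ∂P, ∃ M, ∀ k ≥ k₀, (E k).indicator (F k) ω ≤ M := by
      refine ae_exists_le_of_condExp_le (ℱ := past hd)
        (ε := fun k => 2 * (C * (1 + |R|)) * (w (k + 1) * step k ^ 2)) k₀
        (f := fun k => (E k).indicator (F k))
        (fun k => (hFm k).indicator (hEm k))
        (fun k => (hFi k).indicator ((past hd).le k _ (hEm k)))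
        (fun k hk ω => Set.indicator_nonneg (fun ω _ => hg1 k hk _ _) ω)
        (fun k => mul_nonneg (by positivity) (mul_nonneg (hw _) (sq_nonneg _)))
        (hsum.mul_left _) fun k hk => ?_
      -- `E (k + 1)` is not known at time `k`; as `F (k + 1)` is nonnegative, it may be enlarged to
      -- `E k`.
      have hmono : P[(E (k + 1)).indicator (F (k + 1)) | past hd k] ≤ᵐ[P]
          P[(E k).indicator (F (k + 1)) | past hd k] := by
        refine condExp_mono ((hFi _).indicator ((past hd).le _ _ (hEm _)))
          ((hFi _).indicator ((past hd).le _ _ (hEm _))) (ae_of_all _ fun ω => ?_)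
        exact Set.indicator_le_indicator_of_subset (hEs k)
          (fun ω => hg1 (k + 1) (by omega) _ _) ω
      have h := condExp_indicator_estimate_succ hs hd step θ₀ k (hg (k + 1)) (hEm k)
      filter_upwards [hmono, h] with ω h1 h2
      refine h1.trans (h2.trans_le ?_)
      by_cases hω : ω ∈ E k
      · have hV : ‖estimate step θ₀ (fun m => S m ω) k - θs‖ ^ 2 ≤ R :=
          hω k (Finset.mem_Icc.2 ⟨hk, le_rfl⟩)
        rw [Set.indicator_of_mem hω, Set.indicator_of_mem hω]
        simp only [hF]
        generalize estimate step θ₀ (fun m => S m ω) k = θ at hV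
        generalize S k ω = s
        have hCθ : ∀ z, ‖score θ z‖ ^ 2 ≤ C * (1 + |R|) := fun z =>
          (hC θ z).trans (by gcongr; exact hV.trans (le_abs_self R))
        have h3 := sum_transProb_mul_lyapunov_update_le s (hstep k) (hstep (k + 1)) hκ.le
          (hK (k + 1) (by omega)).2 hp0.le hp hCθ (hdrift θ s hV)
        have h4 : 0 ≤ lyapunov κ (step k) θs θ s := by
          refine le_trans (by positivity) (half_norm_sq_le_lyapunov hκ.le (hstep k)
            (hK k (hk₀.trans hk)).2 θs θ s)
        have h5 := mul_le_mul_of_nonneg_right (hK k (hk₀.trans hk)).1 h4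
        calc ∑ s', transProb θs s s' * g (k + 1) (update (step k) θ (s', s)) s'
            = w (k + 1) * ∑ s', transProb θs s s' *
                lyapunov κ (step (k + 1)) θs (update (step k) θ (s', s)) s' := by
              rw [Finset.mul_sum]
              exact Finset.sum_congr rfl fun s' _ => by simp only [g]; ring
          _ ≤ _ := mul_le_mul_of_nonneg_left h3 (hw (k + 1))
          _ ≤ _ := by
              simp only [g]
              linarith
      · rw [Set.indicator_of_notMem hω, Set.indicator_of_notMem hω, zero_add]
        exact mul_nonneg (by positivity) (mul_nonneg (hw _) (sq_nonneg _))
    filter_upwards [hbdd] with ω ⟨M, hM⟩ hω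
    refine ⟨2 * M, fun k hk => ?_⟩
    have h1 := hM k hk
    rw [Set.indicator_of_mem (show ω ∈ E k from fun j hj => hω j (Finset.mem_Icc.1 hj).1)] at h1
    have h2 := (hg0 k hk _ _).trans h1
    simp only [sqError]
    linarith
  -- The time from which the error stays below `R` is random; countably many `k₀` cover all cases.
  have hall : ∀ᵐ ω ∂P, ∀ k₀, K ≤ k₀ →
      (∀ k ≥ k₀, sqError θs step θ₀ (fun m => S m ω) k ≤ R) →
      ∃ M, ∀ k ≥ k₀, w k * sqError θs step θ₀ (fun m => S m ω) k ≤ M := by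
    rw [ae_all_iff]
    intro k₀
    by_cases h : K ≤ k₀
    · filter_upwards [key k₀ h] with ω hω _ using hω
    · exact ae_of_all _ fun ω h' => absurd h' h
  filter_upwards [hall] with ω hω hev
  obtain ⟨k₁, hk₁⟩ := eventually_atTop.1 hev
  obtain ⟨M, hM⟩ := hω (max K k₁) (le_max_left _ _)
    fun k hk => hk₁ k ((le_max_right _ _).trans hk)
  exact ⟨M, eventually_atTop.2 ⟨_, hM⟩⟩

end Convergence

/-! ### Step sizes and polynomial weights -/

section StepSize

lemma stepSize_nonneg {a β γ : ℝ} (ha : 0 < a) (hγ : 0 < γ) (k : ℕ) : 0 ≤ stepSize a β γ k := by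
  unfold stepSize
  positivity

lemma stepSize_le {a β γ : ℝ} (ha : 0 < a) (hγ : 0 < γ) {k : ℕ} (hk : 0 < k) :
    stepSize a β γ k ≤ a * (k : ℝ) ^ (-(1 - β)) := by
  have hk' : (0 : ℝ) < (k : ℝ) ^ (1 - β) := Real.rpow_pos_of_pos (by exact_mod_cast hk) _
  rw [Real.rpow_neg (Nat.cast_nonneg k), ← div_eq_mul_inv, stepSize]
  gcongr
  linarith

lemma tendsto_stepSize {a β γ : ℝ} (ha : 0 < a) (hβ : β < 1) (hγ : 0 < γ) :
    Tendsto (stepSize a β γ) atTop (nhds 0) := by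
  have h : Tendsto (fun k : ℕ => a * (k : ℝ) ^ (-(1 - β))) atTop (nhds (a * 0)) :=
    ((tendsto_rpow_neg_atTop (by linarith)).comp tendsto_natCast_atTop_atTop).const_mul a
  rw [mul_zero] at h
  refine squeeze_zero' (Eventually.of_forall fun k => stepSize_nonneg ha hγ k) ?_ h
  filter_upwards [eventually_gt_atTop 0] with k hk using stepSize_le ha hγ hk

/-- The terms are of order `k ^ (d - 2 * (1 - β))`; with `d = 2 * q` this produces the threshold `q
< 1 / 2 - β`. -/
lemma summable_rpow_mul_stepSize_sq {a β γ d : ℝ} (ha : 0 < a) (hγ : 0 < γ) (hd : 0 ≤ d)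
    (hdβ : d < 1 - 2 * β) :
    Summable fun k : ℕ => ((k + 1 : ℕ) : ℝ) ^ d * stepSize a β γ k ^ 2 := by
  have h : Summable fun k : ℕ => (2 ^ d * a ^ 2) * (k : ℝ) ^ (d - 2 * (1 - β)) :=
    (Real.summable_nat_rpow.2 (by linarith)).mul_left _
  refine summable_of_isBigO_nat h (IsBigO.of_bound 1 ?_)
  filter_upwards [eventually_gt_atTop 0] with k hk
  have hk' : (0 : ℝ) < k := by exact_mod_cast hk
  have h1 : (1 : ℝ) ≤ k := by exact_mod_cast hk
  have hs := stepSize_nonneg (β := β) ha hγ k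
  rw [one_mul, Real.norm_of_nonneg (by positivity), Real.norm_of_nonneg (by positivity)]
  calc ((k + 1 : ℕ) : ℝ) ^ d * stepSize a β γ k ^ 2
      ≤ (2 * (k : ℝ)) ^ d * (a * (k : ℝ) ^ (-(1 - β))) ^ 2 := by
        gcongr
        · push_cast
          linarith
        · exact stepSize_le ha hγ hk
    _ = _ := by
        rw [Real.mul_rpow two_pos.le hk'.le, mul_pow, ← Real.rpow_mul_natCast hk'.le,
          Real.rpow_sub hk', Nat.cast_ofNat, neg_mul, Real.rpow_neg hk'.le, mul_comm (1 - β) 2]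
        ring

lemma summable_stepSize_sq {a β γ : ℝ} (ha : 0 < a) (hγ : 0 < γ) (hβ : β < 1 / 2) :
    Summable fun k : ℕ => stepSize a β γ k ^ 2 := by
  simpa using summable_rpow_mul_stepSize_sq (β := β) (d := 0) ha hγ le_rfl (by linarith)

/-- The weight grows at most by the factor `exp (d / k)`, while the contraction factor is at most
`exp (-(d / k))` once `d / k ≤ ρ * stepSize a β γ (k + 1)`. The parameter `η` treats both regimes at
once: it is `1` for `β = 0` and arbitrarily small for `β > 0`. -/
lemma eventually_rpow_mul_le {a β γ d ρ η : ℝ} (hγ : 0 < γ) (hd : 0 ≤ d)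
    (hη : ∀ᶠ k : ℕ in atTop, ((k + 1 : ℕ) : ℝ) ^ (1 - β) ≤ η * ((k + 1 : ℕ) : ℝ))
    (hdρ : d * η < ρ * a) :
    ∀ᶠ k : ℕ in atTop, ((k + 1 : ℕ) : ℝ) ^ d * (1 - ρ * stepSize a β γ (k + 1)) ≤ (k : ℝ) ^ d := by
  have hlin : ∀ᶠ k : ℕ in atTop, d * (η + γ) ≤ (ρ * a - d * η) * (k : ℝ) :=
    (tendsto_natCast_atTop_atTop.const_mul_atTop (sub_pos.2 hdρ)).eventually_ge_atTop _
  filter_upwards [hη, hlin, eventually_gt_atTop 0] with k h1 h2 hk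
  have hk' : (0 : ℝ) < k := by exact_mod_cast hk
  have hden : 0 < ((k + 1 : ℕ) : ℝ) ^ (1 - β) + γ := by positivity
  have h3 : d / k ≤ ρ * stepSize a β γ (k + 1) := by
    rw [stepSize, ← mul_div_assoc, div_le_div_iff₀ hk' hden]
    have := mul_le_mul_of_nonneg_left h1 hd
    push_cast at this ⊢
    linarith
  have h4 : ((k + 1 : ℕ) : ℝ) ^ d ≤ (k : ℝ) ^ d * Real.exp (d / k) := by
    have : ((k + 1 : ℕ) : ℝ) ≤ k * Real.exp (1 / k) := by
      have := mul_le_mul_of_nonneg_left (Real.add_one_le_exp (1 / (k : ℝ))) hk'.le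
      rw [mul_add, mul_one_div_cancel hk'.ne'] at this
      push_cast
      linarith
    calc ((k + 1 : ℕ) : ℝ) ^ d ≤ (k * Real.exp (1 / k)) ^ d := by gcongr
      _ = _ := by
        rw [Real.mul_rpow hk'.le (Real.exp_pos _).le, ← Real.exp_mul]
        congr 2
        ring
  calc ((k + 1 : ℕ) : ℝ) ^ d * (1 - ρ * stepSize a β γ (k + 1))
      ≤ ((k + 1 : ℕ) : ℝ) ^ d * Real.exp (-(d / k)) := by
        gcongr
        linarith [Real.add_one_le_exp (-(d / (k : ℝ)))]
    _ ≤ (k : ℝ) ^ d * Real.exp (d / k) * Real.exp (-(d / k)) := by gcongr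
    _ = (k : ℝ) ^ d := by rw [mul_assoc, ← Real.exp_add, add_neg_cancel, Real.exp_zero, mul_one]

lemma eventually_rpow_one_sub_le {β η : ℝ} (hβ : 0 < β) (hη : 0 < η) :
    ∀ᶠ k : ℕ in atTop, ((k + 1 : ℕ) : ℝ) ^ (1 - β) ≤ η * ((k + 1 : ℕ) : ℝ) := by
  have h : Tendsto (fun k : ℕ => ((k + 1 : ℕ) : ℝ) ^ (-β)) atTop (nhds 0) :=
    (tendsto_rpow_neg_atTop hβ).comp
      (tendsto_natCast_atTop_atTop.comp (tendsto_add_atTop_nat 1))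
  filter_upwards [h.eventually (ge_mem_nhds hη)] with k hk
  have hk' : (0 : ℝ) < ((k + 1 : ℕ) : ℝ) := by positivity
  rw [sub_eq_neg_add, Real.rpow_add hk', Real.rpow_one]
  gcongr

lemma isLittleO_of_rpow_mul_sq_le {x : ℕ → ℝ} {d δ M : ℝ} (hδ : δ < d)
    (h : ∀ᶠ k : ℕ in atTop, (k : ℝ) ^ (2 * d) * ‖x k‖ ^ 2 ≤ M) :
    x =o[atTop] fun k : ℕ => (k : ℝ) ^ (-δ) := by
  have h1 : x =O[atTop] fun k : ℕ => (k : ℝ) ^ (-d) := by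
    refine IsBigO.of_bound (√M) ?_
    filter_upwards [h, eventually_gt_atTop 0] with k hM hk
    have hk' : (0 : ℝ) < k := by exact_mod_cast hk
    rw [Real.norm_of_nonneg (by positivity : (0 : ℝ) ≤ (k : ℝ) ^ (-d)), Real.rpow_neg hk'.le,
      ← div_eq_mul_inv, le_div_iff₀ (by positivity)]
    refine Real.le_sqrt_of_sq_le ?_
    rw [mul_pow, ← Real.rpow_mul_natCast hk'.le, mul_comm]
    convert hM using 3
    push_cast
    ring
  have h2 : (fun k : ℕ => (k : ℝ) ^ (-d)) =o[atTop] fun k : ℕ => (k : ℝ) ^ (-δ) := by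
    refine (isLittleO_iff_tendsto' ?_).2 ?_
    · filter_upwards [eventually_gt_atTop 0] with k hk h0
      have hk' : (0 : ℝ) < k := by exact_mod_cast hk
      exact absurd h0 (by positivity)
    · have h3 : Tendsto (fun k : ℕ => (k : ℝ) ^ (-(d - δ))) atTop (nhds 0) :=
        (tendsto_rpow_neg_atTop (sub_pos.2 hδ)).comp tendsto_natCast_atTop_atTop
      refine h3.congr' ?_
      filter_upwards [eventually_gt_atTop 0] with k hk
      have hk' : (0 : ℝ) < k := by exact_mod_cast hk
      rw [← Real.rpow_sub hk']
      congr 1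
      ring
  exact h1.trans_isLittleO h2

end StepSize

/-! ### Convergence rates -/

/-- Rates for the step sizes `a / (k ^ (1 - β) + γ)` on the event that the squared errors are
eventually at most `R`. -/
theorem exists_ae_isLittleO {n : ℕ} (A : Matrix (Fin n) (Fin n) ℝ) (c : Fin n → ℝ) (R : ℝ) :
    ∃ ρ : ℝ, 0 < ρ ∧ ∀ a β γ η b : ℝ, 0 < a → 0 < γ → b ≤ 1 / 2 - β → β < 1 / 2 → 0 ≤ η →
      2 * b * η ≤ ρ * a →
      (∀ᶠ k : ℕ in atTop, ((k + 1 : ℕ) : ℝ) ^ (1 - β) ≤ η * ((k + 1 : ℕ) : ℝ)) →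
      ∀ (Ω : Type u) [MeasurableSpace Ω] (P : Measure Ω) [IsProbabilityMeasure P]
        (D : ℕ → Fin n → Ω → ℝ) (Y : ℕ → Ω → Fin n → ℝ) (S : ℕ → Ω → Obs n),
        IsSystem A c D Y S → IsGaussianDisturbance P D (S 0) → ∀ θ₀ : Param n, ∀ᵐ ω ∂P,
          (∀ᶠ k in atTop,
            sqError (vecParam A c) (stepSize a β γ) θ₀ (fun m => S m ω) k ≤ R) →
          ∀ δ ∈ Set.Ioo 0 b,
          (fun k : ℕ => ‖estimate (stepSize a β γ) θ₀ (fun m => S m ω) k - vecParam A c‖)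
            =o[atTop] (fun k : ℕ => (k : ℝ) ^ (-δ)) := by
  obtain ⟨ρ, hρ, hmain⟩ := exists_ae_weighted_sqError_le.{u} A c R
  refine ⟨ρ, hρ, ?_⟩
  intro a β γ η b ha hγ hbβ hβ hη0 hbη hη Ω _ P _ D Y S hs hd θ₀
  -- Rational exponents leave a single null set for all `δ`; a rational strictly between `δ` and `b`
  -- also turns boundedness into little-o.
  have hq : ∀ᵐ ω ∂P, ∀ q : ℚ, 0 < (q : ℝ) → (q : ℝ) < b →
      (∀ᶠ k in atTop, sqError (vecParam A c) (stepSize a β γ) θ₀ (fun m => S m ω) k ≤ R) →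
      ∃ M, ∀ᶠ k : ℕ in atTop, (k : ℝ) ^ (2 * (q : ℝ)) *
        sqError (vecParam A c) (stepSize a β γ) θ₀ (fun m => S m ω) k ≤ M := by
    rw [ae_all_iff]
    intro q
    by_cases h : 0 < (q : ℝ) ∧ (q : ℝ) < b
    · have hlt : 2 * (q : ℝ) * η < ρ * a := by
        rcases hη0.eq_or_lt with rfl | hpos
        · rw [mul_zero]
          positivity
        · nlinarith [h.2]
      filter_upwards [hmain (stepSize a β γ) (fun k => (k : ℝ) ^ (2 * (q : ℝ)))
        (stepSize_nonneg ha hγ) (tendsto_stepSize ha (by linarith) hγ) (fun k => by positivity)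
        (eventually_rpow_mul_le hγ (by linarith [h.1]) hη hlt)
        (summable_rpow_mul_stepSize_sq ha hγ (by linarith [h.1]) (by linarith [h.2]))
        Ω P D Y S hs hd θ₀] with ω hω _ _ using hω
    · exact ae_of_all _ fun ω h1 h2 => absurd ⟨h1, h2⟩ h
  filter_upwards [hq] with ω hω hR δ hδ
  obtain ⟨q, hδq, hqb⟩ := exists_rat_btwn hδ.2
  obtain ⟨M, hM⟩ := hω q (hδ.1.trans hδq) hqb hR
  refine isLittleO_of_rpow_mul_sq_le hδq (M := M) ?_
  simpa only [norm_norm, sqError] using hM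

lemma eventually_sqError_le_one {n : ℕ} {θs θ₀ : Param n} {step : ℕ → ℝ} {s : ℕ → Obs n} {δ : ℝ}
    (hδ : 0 < δ) (h : (fun k : ℕ => ‖estimate step θ₀ s k - θs‖) =o[atTop]
      fun k : ℕ => (k : ℝ) ^ (-δ)) :
    ∀ᶠ k in atTop, sqError θs step θ₀ s k ≤ 1 := by
  have h1 : Tendsto (fun k : ℕ => (k : ℝ) ^ (-δ)) atTop (nhds 0) :=
    (tendsto_rpow_neg_atTop hδ).comp tendsto_natCast_atTop_atTop
  filter_upwards [(h.trans_tendsto h1).eventually (ge_mem_nhds one_pos)] with k hk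
  exact pow_le_one₀ (norm_nonneg _) hk

end BinaryNetwork

theorem theorem6 {n : ℕ} (hn : 2 ≤ n) (A : Matrix (Fin n) (Fin n) ℝ) (c : Fin n → ℝ)
    (a : ℝ) (ha : 0 < a) :
    (∀ β ∈ Set.Ioo (0 : ℝ) (1 / 3), ∀ γ > (0 : ℝ),
      ∀ (Ω : Type u) [MeasurableSpace Ω] (P : Measure Ω) [IsProbabilityMeasure P]
        (D : ℕ → Fin n → Ω → ℝ) (Y : ℕ → Ω → Fin n → ℝ) (S : ℕ → Ω → Obs n),
        IsSystem A c D Y S → IsGaussianDisturbance P D (S 0) →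
        ∀ θ₀ : Param n, ∀ᵐ ω ∂P, ∀ δ ∈ Set.Ioo (0 : ℝ) (1 / 2 - β),
          (fun k : ℕ => ‖estimate (stepSize a β γ) θ₀ (fun m => S m ω) k - vecParam A c‖)
            =o[atTop] (fun k : ℕ => (k : ℝ) ^ (-δ))) ∧
    (∃ δ' ∈ Set.Ioc (0 : ℝ) (1 / 2), ∀ γ > (0 : ℝ),
      ∀ (Ω : Type u) [MeasurableSpace Ω] (P : Measure Ω) [IsProbabilityMeasure P]
        (D : ℕ → Fin n → Ω → ℝ) (Y : ℕ → Ω → Fin n → ℝ) (S : ℕ → Ω → Obs n),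
        IsSystem A c D Y S → IsGaussianDisturbance P D (S 0) →
        ∀ θ₀ : Param n, ∀ᵐ ω ∂P, ∀ δ ∈ Set.Ioo (0 : ℝ) δ',
          (fun k : ℕ => ‖estimate (stepSize a 0 γ) θ₀ (fun m => S m ω) k - vecParam A c‖)
            =o[atTop] (fun k : ℕ => (k : ℝ) ^ (-δ))) := by
  -- The almost sure bound on the squared error is random; natural numbers `R` cover it with
  -- countably many null sets.
  choose ρ hρ hrate using fun R : ℕ => exists_ae_isLittleO.{u} A c R
  constructor
  · intro β hβ γ hγ Ω _ P _ D Y S hs hd θ₀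
    have hβ' : β < 1 / 2 := by linarith [hβ.2]
    have hR : ∀ᵐ ω ∂P, ∀ R : ℕ, _ := ae_all_iff.2 fun R =>
      -- With `b = 1 / 2 - β` one has `2 * b < 1`, so `η = ρ R * a` satisfies `2 * b * η ≤ ρ R * a`
      -- for every `R`.
      hrate R a β γ (ρ R * a) (1 / 2 - β) ha hγ le_rfl hβ' (mul_pos (hρ R) ha).le
        (by nlinarith [mul_pos (hρ R) ha, hβ.1])
        (eventually_rpow_one_sub_le hβ.1 (mul_pos (hρ R) ha)) Ω P D Y S hs hd θ₀
    filter_upwards [hR, ae_exists_sqError_le hs hd (stepSize_nonneg ha hγ)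
      (summable_stepSize_sq ha hγ hβ') θ₀] with ω hω ⟨M, hM⟩
    obtain ⟨R, hMR⟩ := exists_nat_ge M
    exact hω R (Eventually.of_forall fun k => (hM k).trans hMR)
  · have hη : ∀ᶠ k : ℕ in atTop, ((k + 1 : ℕ) : ℝ) ^ (1 - (0 : ℝ)) ≤ 1 * ((k + 1 : ℕ) : ℝ) :=
      Eventually.of_forall fun k => by simp
    have hb : ∀ R, 0 < min (1 / 2) (ρ R * a / 2) := fun R =>
      lt_min (by norm_num) (by have := mul_pos (hρ R) ha; linarith)
    refine ⟨min (1 / 2) (ρ 1 * a / 2), ⟨hb 1, min_le_left _ _⟩, ?_⟩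
    intro γ hγ Ω _ P _ D Y S hs hd θ₀
    have hR : ∀ᵐ ω ∂P, ∀ R : ℕ, _ := ae_all_iff.2 fun R =>
      hrate R a 0 γ 1 (min (1 / 2) (ρ R * a / 2)) ha hγ
        (by rw [sub_zero]; exact min_le_left _ _) (by norm_num) zero_le_one
        (by linarith [min_le_right (1 / 2) (ρ R * a / 2)]) hη Ω P D Y S hs hd θ₀
    filter_upwards [hR, ae_exists_sqError_le hs hd (stepSize_nonneg ha hγ)
      (summable_stepSize_sq (β := 0) ha hγ (by norm_num)) θ₀] with ω hω ⟨M, hM⟩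
    obtain ⟨R, hMR⟩ := exists_nat_ge M
    have hδ := half_pos (hb R)
    -- Any positive rate suffices here, even one depending on the random `R`: it brings the squared
    -- error below `1`, where the rate with `ρ 1` applies.
    have h1 := hω R (Eventually.of_forall fun k => (hM k).trans hMR) _
      ⟨hδ, half_lt_self (hb R)⟩
    refine hω 1 ?_
    simpa using eventually_sqError_le_one hδ h1
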